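/- All graphs are finite and simple. For a graph $G$ with vertex set of size $n$, let $Q=D+A$ be its signless Laplacian matrix, where $D$ is the diagonal matrix of vertex degrees and $A$ the adjacency matrix, let $q_1,\dots,q_n$ be the eigenvalues of $Q$ (with multiplicity), and let $SLEE(G)=\sum_{i=1}^{n}e^{q_i}$ be the signless Laplacian Estrada index. A unicyclic graph is a connected graph with as many edges as vertices. For integers $n_1,n_2,n_3\ge 0$ let $C_3S(n_1,n_2,n_3)$ be the graph obtained from a triangle $v_1v_2v_3$ by attaching $n_i$ pendant vertices to $v_i$ for $i=1,2,3$. Put $G^{(1)}=C_3S(n-3,0,0)$ for $n\ge 3$ and $G^{(2)}=C_3S(n-4,1,0)$ for $n\ge 4$; these are unicyclic graphs on $n$ vertices. (1) Let $n\ge 3$. Every unicyclic graph $G$ on $n$ vertices satisfies $SLEE(G)\le SLEE(G^{(1)})$, with equality if and only if $G\cong G^{(1)}$. (2) Let $n\ge 4$. Every unicyclic graph $G$ on $n$ vertices with $G\not\cong G^{(1)}$ satisfies $SLEE(G)\le SLEE(G^{(2)})$, with equality if and only if $G\cong G^{(2)}$. (3) If $n\ge 5$, then $SLEE(G^{(2)})<SLEE(G^{(1)})$.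 In particular, if $n\ge 5$, then every unicyclic graph $G\not\cong G^{(1)}$ on $n$ vertices satisfies $SLEE(G)\le SLEE(G^{(2)})<SLEE(G^{(1)})$, with equality on the left if and only if $G\cong G^{(2)}$. -/

import Mathlib

open Matrix

namespace SimpleGraph

/-- The signless Laplacian matrix `Q = D + A` of a finite simple graph, with real entries. -/
def signlessLapMatrix {V : Type*} [Fintype V] [DecidableEq V] (G : SimpleGraph V)
    [DecidableRel G.Adj] : Matrix V V ℝ :=
  G.degMatrix ℝ + G.adjMatrix ℝ

theorem isHermitian_signlessLapMatrix {V : Type*} [Fintype V] [DecidableEq V]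
    (G : SimpleGraph V) [DecidableRel G.Adj] : G.signlessLapMatrix.IsHermitian :=
  (G.isHermitian_degMatrix ℝ).add (G.isHermitian_adjMatrix ℝ)

/-- The signless Laplacian Estrada index `∑ exp qᵢ`, where the `qᵢ` are the eigenvalues, counted
with multiplicity, of the signless Laplacian matrix. -/
noncomputable def slee {V : Type*} [Fintype V] [DecidableEq V] (G : SimpleGraph V)
    [DecidableRel G.Adj] : ℝ :=
  ∑ i, Real.exp (G.isHermitian_signlessLapMatrix.eigenvalues i)

/-- A (finite) unicyclic graph: connected, with as many edges as vertices. -/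
def IsUnicyclic {V : Type*} [Finite V] (G : SimpleGraph V) : Prop :=
  G.Connected ∧ Nat.card G.edgeSet = Nat.card V

/-- The graph `C_q S(m₀, …, m_{q-1})` (for `q ≥ 3`): the cycle on `Fin q` with `m i` pendant
vertices attached to the cycle vertex `i`. The vertex `Sum.inr ⟨i, k⟩` is the `k`-th pendant
vertex at `i`. -/
def cyclePendant (q : ℕ) (m : Fin q → ℕ) : SimpleGraph (Fin q ⊕ Σ i : Fin q, Fin (m i)) where
  Adj
    | Sum.inl i, Sum.inl j => (cycleGraph q).Adj i j
    | Sum.inl i, Sum.inr p => p.1 = i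
    | Sum.inr p, Sum.inl i => p.1 = i
    | Sum.inr _, Sum.inr _ => False
  symm := ⟨by
    rintro (i | p) (j | r) h
    · exact (cycleGraph q).adj_symm h
    · exact h
    · exact h
    · exact h⟩
  loopless := ⟨by
    rintro (i | p) h
    · exact (cycleGraph q).irrefl h
    · exact h⟩

instance (q : ℕ) (m : Fin q → ℕ) : DecidableRel (cyclePendant q m).Adj
  | Sum.inl i, Sum.inl j => inferInstanceAs (Decidable ((cycleGraph q).Adj i j))
  | Sum.inl i, Sum.inr p => inferInstanceAs (Decidable (p.1 = i))
  | Sum.inr p, Sum.inl i => inferInstanceAs (Decidable (p.1 = i))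
  | Sum.inr _, Sum.inr _ => inferInstanceAs (Decidable False)

/-- `G⁽¹⁾ = C₃S(n-3, 0, 0)`, a graph on `n` vertices when `n ≥ 3`. -/
abbrev maxUnicyclic (n : ℕ) := cyclePendant 3 ![n - 3, 0, 0]

/-- `G⁽²⁾ = C₃S(n-4, 1, 0)`, a graph on `n` vertices when `n ≥ 4`. -/
abbrev secondMaxUnicyclic (n : ℕ) := cyclePendant 3 ![n - 4, 1, 0]

end SimpleGraph

/-! By the exponential series, `slee` is the sum of tr(Q^k)/k!, so indices are compared through
power traces. The basic move is `shift`, which replaces the edges v b, for b in a set B, by u b.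
Take an involution of the vertices that exchanges u with v and, where needed, pendant vertices at v
with pendant vertices at u. In the basis of its fixed points and of the symmetric and antisymmetric
vectors of its 2-cycles, the new matrix dominates the absolute values of the old one entrywise.
Hence no power trace decreases (`trace_pow_le_of_foldEntry`), and tr(Q²) increases strictly
(`slee_lt_slee_shift`). The graph stays unicyclic if u and v are adjacent or have a common neighbour
(`IsUnicyclic.shift`).

A unicyclic graph with a dominating vertex is a star plus one edge, that is G⁽¹⁾. Any other admits
an improving shift towards a vertex of maximum degree (`IsUnicyclic.exists_slee_lt`). Only finitely
many graphs live on a given vertex set, so the maximum is attained, and it can only be attained at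
G⁽¹⁾.

For the second maximum the same argument runs inside the class of unicyclic graphs without
dominating vertex, where a shift is admissible only if u keeps a non-neighbour. Edge counting and
admissible shifts reduce the graph to a triangle with pendant vertices at two corners c and a.
Moving all pendant vertices from a to c would make c dominating, so a single one is moved, and those
that stay at a are matched by the involution with pendant vertices at c. This ends at one pendant
vertex at a, that is at G⁽²⁾ (`IsUnicyclic.exists_slee_lt_or_adj_iff`). -/

namespace Matrix

/-! ### Power traces of matrices and folding along an involution. -/

variable {V : Type*} [Fintype V] [DecidableEq V]

theorem abs_pow_apply_le {M M' : Matrix V V ℝ} (h : ∀ i j, |M i j| ≤ M' i j) (k : ℕ) (i j : V) :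
    |(M ^ k) i j| ≤ (M' ^ k) i j := by
  induction k generalizing j with
  | zero =>
    rw [pow_zero, pow_zero, Matrix.one_apply]
    split_ifs <;> simp
  | succ k ih =>
    rw [pow_succ, pow_succ, Matrix.mul_apply, Matrix.mul_apply]
    refine (Finset.abs_sum_le_sum_abs _ _).trans (Finset.sum_le_sum fun l _ => ?_)
    rw [abs_mul]
    exact mul_le_mul (ih l) (h l j) (abs_nonneg _) ((abs_nonneg _).trans (ih l))

/-- Up to a positive factor depending on `i`, the `(i, j)` entry of `M` in the basis formed by
the fixed points of the involution `σ` and the vectors `x + σ x`, `x - σ x`. -/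
def foldEntry (σ : V → V) (α β : V → ℝ) (M : Matrix V V ℝ) (i j : V) : ℝ :=
  α i * (α j * M i j + β j * M i (σ j)) + β i * (α j * M (σ i) j + β j * M (σ i) (σ j))

/-- If `M'` dominates `M` entrywise in absolute value, in the basis of symmetric and antisymmetric
vectors of an involution, then the power traces of `M'` dominate those of `M`. -/
theorem trace_pow_le_of_foldEntry {σ : V → V} (hσ : ∀ x, σ (σ x) = x) {α β : V → ℝ}
    (hα : ∀ x, α x * α x = 1) (hfix : ∀ x, σ x = x → β x = 0)
    (hmov : ∀ x, σ x ≠ x → β x = 1 ∧ α (σ x) = - α x) {M M' : Matrix V V ℝ}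
    (h : ∀ i j, |foldEntry σ α β M i j| ≤ foldEntry σ α β M' i j) (k : ℕ) :
    (M ^ k).trace ≤ (M' ^ k).trace := by
  have hβ : ∀ x, 0 ≤ β x := fun x => by
    by_cases hx : σ x = x
    · rw [hfix x hx]
    · rw [(hmov x hx).1]; exact zero_le_one
  -- The columns of `S` are the adapted basis vectors and `T` is its inverse. The factor `(1 + β
  -- i)⁻¹` is 1/2 at moved points and 1 at fixed points. Being positive, it does not affect
  -- entrywise domination.
  set S : Matrix V V ℝ :=
    Matrix.of fun i j => α j * (if i = j then 1 else 0) + β j * (if i = σ j then 1 else 0) with hS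
  set T : Matrix V V ℝ := Matrix.of fun i j =>
    (1 + β i)⁻¹ * (α i * (if i = j then 1 else 0) + β i * (if σ i = j then 1 else 0)) with hT
  have hTM : ∀ (X : Matrix V V ℝ) i j,
      (T * X) i j = (1 + β i)⁻¹ * (α i * X i j + β i * X (σ i) j) := by
    intro X i j
    simp only [hT, Matrix.mul_apply, Matrix.of_apply, mul_assoc, add_mul, mul_add,
      Finset.sum_add_distrib, ← Finset.mul_sum, ite_mul, one_mul, zero_mul, Finset.sum_ite_eq,
      Finset.mem_univ, if_true]
  have hMS : ∀ (X : Matrix V V ℝ) i j, (X * S) i j = α j * X i j + β j * X i (σ j) := by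
    intro X i j
    simp only [hS, Matrix.mul_apply, Matrix.of_apply, mul_add, Finset.sum_add_distrib, mul_ite,
      mul_one, mul_zero, Finset.sum_ite_eq', Finset.mem_univ, if_true]
    ring
  have hTS : T * S = 1 := by
    ext i j
    rw [hTM, Matrix.one_apply]
    simp only [hS, Matrix.of_apply]
    by_cases hi : σ i = i
    · rw [hfix i hi]
      by_cases hij : i = j
      · subst hij; simp [hfix i hi, hα]
      · have : i ≠ σ j := fun h => hij (by rw [← hi, h, hσ])
        simp [hij, this]
    · obtain ⟨hb, ha⟩ := hmov i hi
      rw [hb]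
      by_cases hij : i = j
      · subst hij
        rw [if_pos rfl, if_neg (Ne.symm hi), if_neg hi, if_pos rfl, hb]
        linear_combination (1 / 2 : ℝ) * hα i
      · by_cases hj : σ i = j
        · have h1 : i = σ j := by rw [← hj, hσ]
          have h2 : σ i ≠ σ j := fun h => hi (h.trans h1.symm)
          rw [if_neg hij, if_pos h1, if_pos hj, if_neg h2]
          have : β j = 1 := (hmov j (fun h => hij (h1.trans h))).1
          rw [this, ← hj, ha]; ring
        · have h1 : i ≠ σ j := fun h => hj (by rw [h, hσ])
          have h2 : σ i ≠ σ j := fun h => hij (by rw [← hσ i, h, hσ])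
          simp [hij, h1, h2, hj]
  have hST : S * T = 1 := mul_eq_one_comm.mp hTS
  have hconj : ∀ X : Matrix V V ℝ, ((T * X * S) ^ k).trace = (X ^ k).trace := by
    intro X
    have : (T * X * S) ^ k = T * X ^ k * S := by
      induction k with
      | zero => simp [hTS]
      | succ k ih =>
        rw [pow_succ, ih, pow_succ]
        calc T * X ^ k * S * (T * X * S) = T * X ^ k * (S * T) * X * S := by
              simp only [Matrix.mul_assoc]
          _ = _ := by rw [hST, Matrix.mul_one]; simp only [Matrix.mul_assoc]
    rw [this, Matrix.trace_mul_comm, ← Matrix.mul_assoc, hST, Matrix.one_mul]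
  have hentry : ∀ (X : Matrix V V ℝ) i j,
      (T * X * S) i j = (1 + β i)⁻¹ * foldEntry σ α β X i j := by
    intro X i j
    rw [hMS, hTM, hTM, foldEntry]; ring
  rw [← hconj M, ← hconj M']
  refine Finset.sum_le_sum fun i _ => (le_abs_self _).trans (abs_pow_apply_le (fun a b => ?_) k i i)
  rw [hentry, hentry, abs_mul, abs_of_nonneg (inv_nonneg.2 (add_nonneg zero_le_one (hβ a)))]
  exact mul_le_mul_of_nonneg_left (h a b) (inv_nonneg.2 (add_nonneg zero_le_one (hβ a)))

theorem IsHermitian.trace_pow_eq_sum {A : Matrix V V ℝ} (hA : A.IsHermitian) (k : ℕ) :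
    (A ^ k).trace = ∑ i, hA.eigenvalues i ^ k := by
  have h := hA.spectral_theorem
  have h2 : A ^ k = Unitary.conjStarAlgAut ℝ _ hA.eigenvectorUnitary
      ((diagonal (RCLike.ofReal ∘ hA.eigenvalues)) ^ k) := by
    rw [map_pow, ← h]
  rw [h2, Unitary.conjStarAlgAut_apply, Matrix.trace_mul_cycle]
  simp [Matrix.diagonal_pow, Matrix.trace]

theorem IsHermitian.hasSum_trace_pow {A : Matrix V V ℝ} (hA : A.IsHermitian) :
    HasSum (fun k : ℕ => (A ^ k).trace / k.factorial) (∑ i, Real.exp (hA.eigenvalues i)) := by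
  simp_rw [hA.trace_pow_eq_sum, Finset.sum_div]
  refine hasSum_sum fun i _ => ?_
  rw [Real.exp_eq_exp_ℝ]
  exact NormedSpace.expSeries_div_hasSum_exp _

end Matrix

/-! ### The signless Laplacian and its index as a series of power traces. -/

namespace SimpleGraph

variable {V W : Type*} [Fintype V] [DecidableEq V] [Fintype W] [DecidableEq W]

theorem signlessLapMatrix_apply_self (G : SimpleGraph V) [DecidableRel G.Adj] (x : V) :
    G.signlessLapMatrix x x = G.degree x := by
  simp [signlessLapMatrix, degMatrix]

theorem signlessLapMatrix_apply_ne (G : SimpleGraph V) [DecidableRel G.Adj] {x y : V}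
    (h : x ≠ y) : G.signlessLapMatrix x y = if G.Adj x y then 1 else 0 := by
  simp [signlessLapMatrix, degMatrix, h, adjMatrix_apply]

theorem signlessLapMatrix_nonneg (G : SimpleGraph V) [DecidableRel G.Adj] (x y : V) :
    0 ≤ G.signlessLapMatrix x y := by
  by_cases h : x = y
  · subst h; rw [signlessLapMatrix_apply_self]; positivity
  · rw [signlessLapMatrix_apply_ne G h]; split_ifs <;> simp

theorem signlessLapMatrix_comm (G : SimpleGraph V) [DecidableRel G.Adj] (x y : V) :
    G.signlessLapMatrix x y = G.signlessLapMatrix y x := by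
  by_cases h : x = y
  · subst h; rfl
  · rw [signlessLapMatrix_apply_ne G h, signlessLapMatrix_apply_ne G (Ne.symm h)]
    simp [G.adj_comm]

theorem hasSum_slee (G : SimpleGraph V) [DecidableRel G.Adj] :
    HasSum (fun k : ℕ => (G.signlessLapMatrix ^ k).trace / k.factorial) G.slee :=
  G.isHermitian_signlessLapMatrix.hasSum_trace_pow

theorem slee_congr {G : SimpleGraph V} [DecidableRel G.Adj] {H : SimpleGraph W}
    [DecidableRel H.Adj] (e : G ≃g H) : G.slee = H.slee := by
  have hQ : G.signlessLapMatrix = H.signlessLapMatrix.submatrix e.toEquiv e.toEquiv := by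
    ext x y
    rw [Matrix.submatrix_apply]
    by_cases h : x = y
    · subst h
      rw [signlessLapMatrix_apply_self, signlessLapMatrix_apply_self]
      exact_mod_cast (e.degree_eq x).symm
    · rw [signlessLapMatrix_apply_ne G h, signlessLapMatrix_apply_ne H (by simpa using h)]
      exact if_congr e.map_adj_iff.symm rfl rfl
  have htr : ∀ k : ℕ, (G.signlessLapMatrix ^ k).trace = (H.signlessLapMatrix ^ k).trace := by
    intro k
    have : G.signlessLapMatrix ^ k = (H.signlessLapMatrix ^ k).submatrix e.toEquiv e.toEquiv := by
      rw [hQ]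
      induction k with
      | zero => simp only [pow_zero, Matrix.submatrix_one_equiv]
      | succ k ih => rw [pow_succ, pow_succ, ih, Matrix.submatrix_mul_equiv]
    rw [this]
    exact e.toEquiv.sum_comp fun i => (H.signlessLapMatrix ^ k) i i
  have h := G.hasSum_slee
  simp_rw [htr] at h
  exact h.unique H.hasSum_slee

/-- Termwise comparison of the exponential series. Strictness is asked at exponent 2, the first one
that can separate graphs with equally many vertices and edges, as tr(Q) is the degree sum. -/
theorem slee_lt_of_trace_le {G : SimpleGraph V} [DecidableRel G.Adj] {H : SimpleGraph V}
    [DecidableRel H.Adj]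
    (h : ∀ k : ℕ, (G.signlessLapMatrix ^ k).trace ≤ (H.signlessLapMatrix ^ k).trace)
    (h2 : (G.signlessLapMatrix ^ 2).trace < (H.signlessLapMatrix ^ 2).trace) :
    G.slee < H.slee := by
  refine hasSum_lt (i := 2) (fun k => ?_) ?_ G.hasSum_slee H.hasSum_slee
  · exact div_le_div_of_nonneg_right (h k) (by positivity)
  · exact div_lt_div_of_pos_right h2 (by positivity)

theorem trace_signlessLapMatrix_sq (G : SimpleGraph V) [DecidableRel G.Adj] :
    (G.signlessLapMatrix ^ 2).trace = ∑ x, ((G.degree x : ℝ) ^ 2 + G.degree x) := by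
  refine Finset.sum_congr rfl fun x _ => ?_
  rw [Matrix.diag_apply, pow_two, Matrix.mul_apply]
  have : ∀ y, G.signlessLapMatrix x y * G.signlessLapMatrix y x =
      (if x = y then (G.degree x : ℝ) ^ 2 else 0) + (if G.Adj x y then 1 else 0) := by
    intro y
    by_cases h : x = y
    · subst h; simp [signlessLapMatrix_apply_self, pow_two]
    · rw [signlessLapMatrix_comm G y x, signlessLapMatrix_apply_ne G h]; simp [h]
  simp_rw [this, Finset.sum_add_distrib]
  congr 1
  · simp
  · rw [Finset.sum_boole, ← card_neighborFinset_eq_degree]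
    simp [neighborFinset_eq_filter]

end SimpleGraph

/-! ### Shifting edges from one vertex to another. -/

namespace SimpleGraph

variable {V : Type*} [Fintype V] [DecidableEq V]

omit [Fintype V] in
theorem eq_or_mem_or_fixed (u v : V) (R : Finset V) (f : V → V) (x : V) :
    x = u ∨ x = v ∨ x ∈ R ∨ (∃ r ∈ R, x = f r) ∨
      (x ≠ u ∧ x ≠ v ∧ x ∉ R ∧ ∀ r ∈ R, x ≠ f r) := by
  by_cases h : ∃ r ∈ R, x = f r
  · exact Or.inr (Or.inr (Or.inr (Or.inl h)))
  · have : ∀ r ∈ R, x ≠ f r := fun r hr e => h ⟨r, hr, e⟩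
    tauto

omit [Fintype V] in
/-- The involution exchanging `u` with `v` and each `r ∈ R` with `f r`, together with its signs. -/
theorem exists_involution {u v : V} {R : Finset V} {f : V → V} (huv : u ≠ v) (huR : u ∉ R)
    (hvR : v ∉ R) (hinj : Set.InjOn f R) (hfR : ∀ r ∈ R, f r ∉ R ∧ f r ≠ u ∧ f r ≠ v) :
    ∃ (σ : V → V) (α β : V → ℝ), (∀ x, σ (σ x) = x) ∧ (∀ x, α x * α x = 1) ∧
      (∀ x, σ x = x → β x = 0) ∧ (∀ x, σ x ≠ x → β x = 1 ∧ α (σ x) = - α x) ∧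
      (σ u = v ∧ α u = 1 ∧ β u = 1) ∧ (σ v = u ∧ α v = -1 ∧ β v = 1) ∧
      (∀ r ∈ R, σ r = f r ∧ α r = -1 ∧ β r = 1) ∧
      (∀ r ∈ R, σ (f r) = r ∧ α (f r) = 1 ∧ β (f r) = 1) ∧
      (∀ x, x ≠ u → x ≠ v → x ∉ R → (∀ r ∈ R, x ≠ f r) → σ x = x ∧ α x = 1 ∧ β x = 0) := by
  classical
  set σ : V → V := fun x => if x = u then v else if x = v then u else if x ∈ R then f x else
    if h : ∃ r ∈ R, x = f r then h.choose else x with hσ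
  have su : σ u = v := by simp [hσ]
  have sv : σ v = u := by simp [hσ, huv.symm]
  have sR : ∀ r ∈ R, σ r = f r := fun r hr => by
    have h1 : r ≠ u := fun h => huR (h ▸ hr)
    have h2 : r ≠ v := fun h => hvR (h ▸ hr)
    simp [hσ, h1, h2, hr]
  have sf : ∀ r ∈ R, σ (f r) = r := fun r hr => by
    obtain ⟨h0, h1, h2⟩ := hfR r hr
    have h3 : ∃ s ∈ R, f r = f s := ⟨r, hr, rfl⟩
    have h4 : σ (f r) = h3.choose := by
      simp only [hσ, if_neg h1, if_neg h2, if_neg h0, dif_pos h3]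
    rw [h4]
    exact hinj h3.choose_spec.1 hr h3.choose_spec.2.symm
  have sx : ∀ x, x ≠ u → x ≠ v → x ∉ R → (∀ r ∈ R, x ≠ f r) → σ x = x := by
    intro x h1 h2 h3 h4
    have h5 : ¬ ∃ r ∈ R, x = f r := fun ⟨r, hr, h⟩ => h4 r hr h
    simp only [hσ, if_neg h1, if_neg h2, if_neg h3, dif_neg h5]
  have cls := eq_or_mem_or_fixed u v R f
  have hne : ∀ r ∈ R, f r ≠ r := fun r hr h => (hfR r hr).1 (h.symm ▸ hr)
  -- The antisymmetric vectors are indexed by `v` and `R` and oriented as u - v and f r - r, towards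
  -- the side of `u`. This orientation makes the folded entries nonnegative.
  refine ⟨σ, fun x => if x = v ∨ x ∈ R then -1 else 1, fun x => if σ x = x then 0 else 1,
    ?_, ?_, ?_, ?_, ?_, ?_, ?_, ?_, ?_⟩
  · intro x
    rcases cls x with rfl | rfl | h | ⟨r, hr, rfl⟩ | ⟨h1, h2, h3, h4⟩
    · rw [su, sv]
    · rw [sv, su]
    · rw [sR x h, sf x h]
    · rw [sf r hr, sR r hr]
    · rw [sx x h1 h2 h3 h4, sx x h1 h2 h3 h4]
  · intro x
    dsimp only
    split_ifs <;> norm_num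
  · intro x hx
    simp [hx]
  · intro x hx
    refine ⟨by simp [hx], ?_⟩
    rcases cls x with rfl | rfl | h | ⟨r, hr, rfl⟩ | ⟨h1, h2, h3, h4⟩
    · simp [su, huv, huR]
    · simp [sv, huv, huR]
    · simp [sR x h, h, hfR x h]
    · simp [sf r hr, hr, hfR r hr]
    · exact absurd (sx x h1 h2 h3 h4) hx
  · simp [su, huv, huv.symm, huR]
  · simp [sv, huv]
  · intro r hr
    simp [sR r hr, hr, hne r hr]
  · intro r hr
    simp [sf r hr, hfR r hr, (hne r hr).symm]
  · intro x h1 h2 h3 h4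
    simp [sx x h1 h2 h3 h4, h2, h3]

omit [Fintype V] [DecidableEq V] in
theorem foldEntry_comm {σ : V → V} {α β : V → ℝ} {X : Matrix V V ℝ} (hX : ∀ x y, X x y = X y x)
    (i j : V) : foldEntry σ α β X i j = foldEntry σ α β X j i := by
  simp only [foldEntry, hX j, hX (σ j)]
  ring

omit [Fintype V] in
/-- Nonnegativity of the folded entries of a matrix in which each `r ∈ R` is coupled only to
itself and `v`, and each `f r` only to itself and `u`. -/
theorem foldEntry_nonneg {u v : V} {R : Finset V} {f : V → V}
    (hinj : Set.InjOn f R)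
    {σ : V → V} {α β : V → ℝ}
    (su : σ u = v ∧ α u = 1 ∧ β u = 1) (sv : σ v = u ∧ α v = -1 ∧ β v = 1)
    (sR : ∀ r ∈ R, σ r = f r ∧ α r = -1 ∧ β r = 1)
    (sf : ∀ r ∈ R, σ (f r) = r ∧ α (f r) = 1 ∧ β (f r) = 1)
    (sx : ∀ x, x ≠ u → x ≠ v → x ∉ R → (∀ r ∈ R, x ≠ f r) → σ x = x ∧ α x = 1 ∧ β x = 0)
    {X : Matrix V V ℝ} (hX : ∀ x y, X x y = X y x) {c : ℝ} (hc : 0 ≤ c)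
    (hRv : ∀ r ∈ R, X r v = c) (hRr : ∀ r ∈ R, X r r = c)
    (hR0 : ∀ r ∈ R, ∀ y, y ≠ r → y ≠ v → X r y = 0)
    (hfu : ∀ r ∈ R, X (f r) u = c) (hff : ∀ r ∈ R, X (f r) (f r) = c)
    (hf0 : ∀ r ∈ R, ∀ y, y ≠ f r → y ≠ u → X (f r) y = 0)
    (huR : u ∉ R) (hfR : ∀ r ∈ R, f r ∉ R ∧ f r ≠ u ∧ f r ≠ v) (hvR : v ∉ R) (huv : u ≠ v)
    (h1 : X v v ≤ X u u) (h2 : 2 * X u v ≤ X u u + X v v) (h3 : 0 ≤ X u u + X v v + 2 * X u v)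
    (h4 : ∀ x, x ≠ u → x ≠ v → x ∉ R → (∀ r ∈ R, x ≠ f r) → X x v ≤ X x u ∧ 0 ≤ X x u + X x v)
    (h5 : ∀ x y, x ≠ u → x ≠ v → y ≠ u → y ≠ v → 0 ≤ X x y) (i j : V) :
    0 ≤ foldEntry σ α β X i j := by
  have cls := eq_or_mem_or_fixed u v R f
  have neR : ∀ r ∈ R, r ≠ u ∧ r ≠ v := fun r hr => ⟨fun h => huR (h ▸ hr), fun h => hvR (h ▸ hr)⟩
  have hRu : ∀ r ∈ R, X r u = 0 := fun r hr => hR0 r hr u (neR r hr).1.symm huv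
  have hfv : ∀ r ∈ R, X (f r) v = 0 := fun r hr =>
    hf0 r hr v (hfR r hr).2.2.symm huv.symm
  have hRf : ∀ r ∈ R, ∀ s ∈ R, X r (f s) = 0 := fun r hr s hs =>
    hR0 r hr _ (fun h => (hfR s hs).1 (h ▸ hr)) (hfR s hs).2.2
  have hRR : ∀ r ∈ R, ∀ s ∈ R, X r s = X (f r) (f s) ∧ 0 ≤ X r s := fun r hr s hs => by
    by_cases h : s = r
    · subst h; rw [hRr s hs, hff s hs]; exact ⟨rfl, hc⟩
    · rw [hR0 r hr s h (neR s hs).2,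
        hf0 r hr _ (fun h' => h (hinj hs hr h')) (hfR s hs).2.1]
      exact ⟨rfl, le_rfl⟩
  have kuu : 0 ≤ foldEntry σ α β X u u := by
    simp only [foldEntry, su]; linarith [hX u v]
  have kuv : 0 ≤ foldEntry σ α β X u v := by
    simp only [foldEntry, su, sv]; linarith [hX u v]
  have kvv : 0 ≤ foldEntry σ α β X v v := by
    simp only [foldEntry, sv]; linarith [hX u v]
  have kRu : ∀ r ∈ R, 0 ≤ foldEntry σ α β X r u := fun r hr => by
    simp only [foldEntry, su, sR r hr, hRu r hr, hRv r hr, hfu r hr, hfv r hr]; linarith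
  have kfu : ∀ r ∈ R, 0 ≤ foldEntry σ α β X (f r) u := fun r hr => by
    simp only [foldEntry, su, sf r hr, hRu r hr, hRv r hr, hfu r hr, hfv r hr]; linarith
  have kRv : ∀ r ∈ R, 0 ≤ foldEntry σ α β X r v := fun r hr => by
    simp only [foldEntry, sv, sR r hr, hRu r hr, hRv r hr, hfu r hr, hfv r hr]; linarith
  have kfv : ∀ r ∈ R, 0 ≤ foldEntry σ α β X (f r) v := fun r hr => by
    simp only [foldEntry, sv, sf r hr, hRu r hr, hRv r hr, hfu r hr, hfv r hr]; linarith
  have kRR : ∀ r ∈ R, ∀ s ∈ R, 0 ≤ foldEntry σ α β X r s := fun r hr s hs => by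
    simp only [foldEntry, sR r hr, sR s hs, hRf r hr s hs, hX (f r) s, hRf s hs r hr]
    linarith [hRR r hr s hs]
  have kRf : ∀ r ∈ R, ∀ s ∈ R, 0 ≤ foldEntry σ α β X r (f s) := fun r hr s hs => by
    simp only [foldEntry, sR r hr, sf s hs, hRf r hr s hs, hX (f r) s, hRf s hs r hr]
    linarith [hRR r hr s hs]
  have kff : ∀ r ∈ R, ∀ s ∈ R, 0 ≤ foldEntry σ α β X (f r) (f s) := fun r hr s hs => by
    simp only [foldEntry, sf r hr, sf s hs, hRf r hr s hs, hX (f r) s, hRf s hs r hr]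
    linarith [hRR r hr s hs]
  have kx : ∀ x, (x ≠ u ∧ x ≠ v ∧ x ∉ R ∧ ∀ r ∈ R, x ≠ f r) → ∀ y,
      0 ≤ foldEntry σ α β X x y := by
    rintro x ⟨g1, g2, g3, g4⟩ y
    obtain ⟨e1, e2, e3⟩ := sx x g1 g2 g3 g4
    have hxR : ∀ r ∈ R, X x r = 0 := fun r hr => by
      rw [hX]; exact hR0 r hr x (fun h => g3 (h ▸ hr)) g2
    have hxf : ∀ r ∈ R, X x (f r) = 0 := fun r hr => by
      rw [hX]; exact hf0 r hr x (g4 r hr) g1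
    have h4' := h4 x g1 g2 g3 g4
    rcases cls y with rfl | rfl | h | ⟨r, hr, rfl⟩ | ⟨k1, k2, k3, k4⟩
    · simp only [foldEntry, e1, e2, e3, su]; linarith
    · simp only [foldEntry, e1, e2, e3, sv]; linarith
    · simp only [foldEntry, e1, e2, e3, sR y h, hxR y h, hxf y h]; linarith
    · simp only [foldEntry, e1, e2, e3, sf r hr, hxR r hr, hxf r hr]; linarith
    · simp only [foldEntry, e1, e2, e3, sx y k1 k2 k3 k4]; linarith [h5 x y g1 g2 k1 k2]
  rcases cls i with rfl | rfl | hi | ⟨r, hr, rfl⟩ | hi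
  · rcases cls j with rfl | rfl | hj | ⟨s, hs, rfl⟩ | hj
    · exact kuu
    · exact kuv
    · rw [foldEntry_comm hX]; exact kRu j hj
    · rw [foldEntry_comm hX]; exact kfu s hs
    · rw [foldEntry_comm hX]; exact kx j hj _
  · rcases cls j with rfl | rfl | hj | ⟨s, hs, rfl⟩ | hj
    · rw [foldEntry_comm hX]; exact kuv
    · exact kvv
    · rw [foldEntry_comm hX]; exact kRv j hj
    · rw [foldEntry_comm hX]; exact kfv s hs
    · rw [foldEntry_comm hX]; exact kx j hj _
  · rcases cls j with rfl | rfl | hj | ⟨s, hs, rfl⟩ | hj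
    · exact kRu i hi
    · exact kRv i hi
    · exact kRR i hi j hj
    · exact kRf i hi s hs
    · rw [foldEntry_comm hX]; exact kx j hj _
  · rcases cls j with rfl | rfl | hj | ⟨s, hs, rfl⟩ | hj
    · exact kfu r hr
    · exact kfv r hr
    · rw [foldEntry_comm hX]; exact kRf j hj r hr
    · exact kff r hr s hs
    · rw [foldEntry_comm hX]; exact kx j hj _
  · exact kx i hi j

/-- The graph obtained from `G` by replacing the edges `v b` with `u b`, for `b ∈ B`. -/
def shift (G : SimpleGraph V) (u v : V) (B : Finset V) : SimpleGraph V where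
  Adj x y := x ≠ y ∧ ((G.Adj x y ∧ ¬ (x = v ∧ y ∈ B) ∧ ¬ (y = v ∧ x ∈ B)) ∨
    (x = u ∧ y ∈ B) ∨ (y = u ∧ x ∈ B))
  symm := ⟨by
    rintro x y ⟨h, h'⟩
    refine ⟨h.symm, ?_⟩
    rw [G.adj_comm]
    tauto⟩
  loopless := ⟨fun x h => h.1 rfl⟩

omit [Fintype V] in
theorem shift_adj {G : SimpleGraph V} {u v : V} {B : Finset V} {x y : V} :
    (G.shift u v B).Adj x y ↔ x ≠ y ∧ ((G.Adj x y ∧ ¬ (x = v ∧ y ∈ B) ∧ ¬ (y = v ∧ x ∈ B)) ∨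
      (x = u ∧ y ∈ B) ∨ (y = u ∧ x ∈ B)) := Iff.rfl

instance (G : SimpleGraph V) [DecidableRel G.Adj] (u v : V) (B : Finset V) :
    DecidableRel (G.shift u v B).Adj := fun x y =>
  inferInstanceAs (Decidable (x ≠ y ∧ ((G.Adj x y ∧ ¬ (x = v ∧ y ∈ B) ∧ ¬ (y = v ∧ x ∈ B)) ∨
    (x = u ∧ y ∈ B) ∨ (y = u ∧ x ∈ B))))

variable {G : SimpleGraph V} [DecidableRel G.Adj] {u v : V} {B R : Finset V}

theorem degree_shift (huv : u ≠ v)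
    (hB : ∀ b ∈ B, G.Adj v b ∧ ¬ G.Adj u b ∧ b ≠ u) (x : V) :
    ((G.shift u v B).degree x : ℝ) =
      G.degree x + (if x = u then (B.card : ℝ) else 0) - (if x = v then (B.card : ℝ) else 0) := by
  have hvB : v ∉ B := fun h => (hB v h).1.ne rfl
  have huB : u ∉ B := fun h => (hB u h).2.2 rfl
  simp only [← card_neighborFinset_eq_degree]
  by_cases hxu : x = u
  · subst hxu
    have : (G.shift x v B).neighborFinset x = G.neighborFinset x ∪ B := by
      ext y
      simp only [mem_neighborFinset, Finset.mem_union, shift_adj]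
      constructor
      · tauto
      · rintro (h | h)
        · exact ⟨h.ne, Or.inl ⟨h, by tauto, by tauto⟩⟩
        · exact ⟨fun e => huB (e ▸ h), by tauto⟩
    rw [this, Finset.card_union_of_disjoint]
    · simp [huv]
    · rw [Finset.disjoint_left]
      intro y hy hyB
      exact (hB y hyB).2.1 (by simpa using hy)
  by_cases hxv : x = v
  · subst hxv
    have : (G.shift u x B).neighborFinset x = G.neighborFinset x \ B := by
      ext y
      simp only [mem_neighborFinset, Finset.mem_sdiff, shift_adj]
      constructor
      · tauto
      · rintro ⟨h, h'⟩
        exact ⟨h.ne, Or.inl ⟨h, by tauto, by tauto⟩⟩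
    have hsub : B ⊆ G.neighborFinset x := fun b hb => by simpa using (hB b hb).1
    rw [this, Finset.card_sdiff_of_subset hsub, Nat.cast_sub (Finset.card_le_card hsub)]
    simp [hxu]
  rw [if_neg hxu, if_neg hxv, add_zero, sub_zero]
  by_cases hxB : x ∈ B
  · obtain ⟨h1, h2, h3⟩ := hB x hxB
    have : (G.shift u v B).neighborFinset x = insert u ((G.neighborFinset x).erase v) := by
      ext y
      simp only [mem_neighborFinset, Finset.mem_insert, Finset.mem_erase, shift_adj]
      constructor
      · tauto
      · rintro (h | ⟨h, h'⟩)
        · exact ⟨h.symm ▸ hxu, by tauto⟩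
        · exact ⟨h'.ne, by tauto⟩
    have hm : v ∈ G.neighborFinset x := by simpa using h1.symm
    have hn : u ∉ (G.neighborFinset x).erase v := by
      simp only [Finset.mem_erase, mem_neighborFinset]
      exact fun h => h2 h.2.symm
    rw [this, Finset.card_insert_of_notMem hn, Finset.card_erase_add_one hm]
  · have : (G.shift u v B).neighborFinset x = G.neighborFinset x := by
      ext y
      simp only [mem_neighborFinset, shift_adj]
      constructor
      · tauto
      · intro h; exact ⟨h.ne, by tauto⟩
    rw [this]

/-- The neighbours of `v` other than `u` are shared with `u`, moved (`B`), or pendant (`R`). The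
pendant ones are mirrored by pendant vertices at `u`, so exchanging `u` with `v` and `R` with its
image leaves `u` the better connected side after the shift. The degree condition says that the new
degree of `u` exceeds the old degree of `v`. -/
theorem slee_lt_slee_shift (huv : u ≠ v) (hB : ∀ b ∈ B, G.Adj v b ∧ ¬ G.Adj u b ∧ b ≠ u)
    (hne : B.Nonempty) (hd : G.degree v < G.degree u + B.card) {f : V → V}
    (hinj : Set.InjOn f R) (hR : ∀ r ∈ R, r ≠ u ∧ r ∉ B ∧ ∀ y, G.Adj r y ↔ y = v)
    (hfR : ∀ r ∈ R, f r ≠ v ∧ ∀ y, G.Adj (f r) y ↔ y = u)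
    (hN : ∀ y, G.Adj v y → y = u ∨ G.Adj u y ∨ y ∈ B ∨ y ∈ R) :
    G.slee < (G.shift u v B).slee := by
  set G' := G.shift u v B with hG'
  have hvB : v ∉ B := fun h => (hB v h).1.ne rfl
  have huB : u ∉ B := fun h => (hB u h).2.2 rfl
  have huR : u ∉ R := fun h => (hR u h).1 rfl
  have hvR : v ∉ R := fun h => G.irrefl (((hR v h).2.2 v).2 rfl)
  have hfR' : ∀ r ∈ R, f r ∉ R ∧ f r ≠ u ∧ f r ≠ v := by
    intro r hr
    refine ⟨fun h => ?_, ?_, (hfR r hr).1⟩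
    · exact huv (((hR _ h).2.2 u).1 (((hfR r hr).2 u).2 rfl))
    · intro h
      have := ((hfR r hr).2 u).2 rfl
      rw [h] at this
      exact G.irrefl this
  have hfB : ∀ r ∈ R, f r ∉ B := fun r hr h =>
    (hB _ h).2.1 (((hfR r hr).2 u).2 rfl).symm
  have hdeg := degree_shift (G := G) huv hB
  have hQ' : ∀ x, x ≠ u → x ≠ v → x ∉ B → ∀ y,
      G'.signlessLapMatrix x y = G.signlessLapMatrix x y := by
    intro x h1 h2 h3 y
    by_cases h : x = y
    · subst h
      rw [signlessLapMatrix_apply_self, signlessLapMatrix_apply_self, hdeg, if_neg h1, if_neg h2]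
      ring
    · rw [signlessLapMatrix_apply_ne _ h, signlessLapMatrix_apply_ne _ h]
      refine if_congr ?_ rfl rfl
      simp only [hG', shift_adj]
      tauto
  have hQ'' : ∀ x y, x ≠ u → x ≠ v → y ≠ u → y ≠ v →
      G'.signlessLapMatrix x y = G.signlessLapMatrix x y := by
    intro x y h1 h2 h3 h4
    by_cases h : x = y
    · subst h
      rw [signlessLapMatrix_apply_self, signlessLapMatrix_apply_self, hdeg, if_neg h1, if_neg h2]
      ring
    · rw [signlessLapMatrix_apply_ne _ h, signlessLapMatrix_apply_ne _ h]
      refine if_congr ?_ rfl rfl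
      simp only [hG', shift_adj]
      tauto
  have hQuv : G'.signlessLapMatrix u v = G.signlessLapMatrix u v := by
    rw [signlessLapMatrix_apply_ne _ huv, signlessLapMatrix_apply_ne _ huv]
    refine if_congr ?_ rfl rfl
    simp only [hG', shift_adj]
    tauto
  have hQuu : G'.signlessLapMatrix u u = G.signlessLapMatrix u u + B.card := by
    rw [signlessLapMatrix_apply_self, signlessLapMatrix_apply_self, hdeg]; simp [huv]
  have hQvv : G'.signlessLapMatrix v v = G.signlessLapMatrix v v - B.card := by
    rw [signlessLapMatrix_apply_self, signlessLapMatrix_apply_self, hdeg]; simp [huv.symm]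
  have hQB : ∀ x ∈ B, G'.signlessLapMatrix x u = 1 ∧ G'.signlessLapMatrix x v = 0 ∧
      G.signlessLapMatrix x u = 0 ∧ G.signlessLapMatrix x v = 1 := by
    intro x hx
    obtain ⟨h1, h2, h3⟩ := hB x hx
    have h4 : x ≠ v := h1.ne'
    rw [signlessLapMatrix_apply_ne _ h3, signlessLapMatrix_apply_ne _ h3,
      signlessLapMatrix_apply_ne _ h4, signlessLapMatrix_apply_ne _ h4]
    refine ⟨if_pos ?_, if_neg ?_, if_neg fun h => h2 h.symm, if_pos h1.symm⟩
    · exact ⟨h3, by tauto⟩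
    · simp only [hG', shift_adj]
      tauto
  have hQR : ∀ r ∈ R, G.signlessLapMatrix r v = 1 ∧ G.signlessLapMatrix r r = 1 ∧
      ∀ y, y ≠ r → y ≠ v → G.signlessLapMatrix r y = 0 := by
    intro r hr
    have h := (hR r hr).2.2
    have hrv : r ≠ v := fun e => hvR (e ▸ hr)
    refine ⟨?_, ?_, ?_⟩
    · rw [signlessLapMatrix_apply_ne _ hrv, if_pos ((h v).2 rfl)]
    · rw [signlessLapMatrix_apply_self, ← card_neighborFinset_eq_degree]
      have : G.neighborFinset r = {v} := by ext y; simp [h]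
      simp [this]
    · intro y h1 h2
      rw [signlessLapMatrix_apply_ne _ h1.symm, if_neg fun e => h2 ((h y).1 e)]
  have hQf : ∀ r ∈ R, G.signlessLapMatrix (f r) u = 1 ∧ G.signlessLapMatrix (f r) (f r) = 1 ∧
      ∀ y, y ≠ f r → y ≠ u → G.signlessLapMatrix (f r) y = 0 := by
    intro r hr
    have h := (hfR r hr).2
    have hru : f r ≠ u := (hfR' r hr).2.1
    refine ⟨?_, ?_, ?_⟩
    · rw [signlessLapMatrix_apply_ne _ hru, if_pos ((h u).2 rfl)]
    · rw [signlessLapMatrix_apply_self, ← card_neighborFinset_eq_degree]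
      have : G.neighborFinset (f r) = {u} := by ext y; simp [h]
      simp [this]
    · intro y h1 h2
      rw [signlessLapMatrix_apply_ne _ h1.symm, if_neg fun e => h2 ((h y).1 e)]
  have hQR' : ∀ r ∈ R, ∀ y, G'.signlessLapMatrix r y = G.signlessLapMatrix r y := fun r hr =>
    hQ' r (hR r hr).1 (fun e => hvR (e ▸ hr)) (hR r hr).2.1
  have hQf' : ∀ r ∈ R, ∀ y, G'.signlessLapMatrix (f r) y = G.signlessLapMatrix (f r) y :=
    fun r hr => hQ' (f r) (hfR' r hr).2.1 (hfR' r hr).2.2 (hfB r hr)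
  have hk : (1 : ℝ) ≤ B.card := by exact_mod_cast hne.card_pos
  have hd' : G.signlessLapMatrix v v < G.signlessLapMatrix u u + B.card := by
    rw [signlessLapMatrix_apply_self, signlessLapMatrix_apply_self]; exact_mod_cast hd
  have hx : ∀ x, x ≠ u → x ≠ v → x ∉ R → x ∉ B →
      G.signlessLapMatrix x v ≤ G.signlessLapMatrix x u := by
    intro x h1 h2 h3 h4
    rw [signlessLapMatrix_apply_ne _ h1, signlessLapMatrix_apply_ne _ h2]
    by_cases h : G.Adj x v
    · have : G.Adj x u := ((hN x h.symm).resolve_left h1).elim (fun h => h.symm)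
        (fun h => (h.elim h4 h3).elim)
      rw [if_pos h, if_pos this]
    · rw [if_neg h]; split_ifs <;> simp
  have hdiag : 2 * G.signlessLapMatrix u v ≤ G.signlessLapMatrix u u + G.signlessLapMatrix v v := by
    have : ∀ {x y : V}, G.Adj x y → (1 : ℝ) ≤ G.degree x := fun h => by
      exact_mod_cast (G.degree_pos_iff_exists_adj _).2 ⟨_, h⟩
    rw [signlessLapMatrix_apply_ne _ huv, signlessLapMatrix_apply_self,
      signlessLapMatrix_apply_self]
    split_ifs with h
    · linarith [this h, this h.symm]
    · rw [mul_zero]; positivity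
  obtain ⟨σ, α, β, a1, a2, a3, a4, su, sv, sR, sf, sx⟩ :=
    exists_involution huv huR hvR hinj hfR'
  refine slee_lt_of_trace_le (fun k => trace_pow_le_of_foldEntry a1 a2 a3 a4 (fun i j => ?_) k) ?_
  -- Folding is linear, so |a| ≤ b for the folded entries follows from nonnegativity of the folded
  -- difference and sum. The pendant rows are unchanged by the shift, whence the constants `c = 0`
  -- for the difference and `c = 2` for the sum.
  · have hsub : 0 ≤ foldEntry σ α β (G'.signlessLapMatrix - G.signlessLapMatrix) i j := by
      refine foldEntry_nonneg hinj su sv sR sf sx ?_ le_rfl ?_ ?_ ?_ ?_ ?_ ?_ huR hfR' hvR huv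
        ?_ ?_ ?_ ?_ ?_ i j <;> simp only [Matrix.sub_apply]
      · intro x y
        rw [signlessLapMatrix_comm, signlessLapMatrix_comm G]
      · intro r hr; rw [hQR' r hr, sub_self]
      · intro r hr; rw [hQR' r hr, sub_self]
      · intro r hr y _ _; rw [hQR' r hr, sub_self]
      · intro r hr; rw [hQf' r hr, sub_self]
      · intro r hr; rw [hQf' r hr, sub_self]
      · intro r hr y _ _; rw [hQf' r hr, sub_self]
      · rw [hQuu, hQvv]; linarith
      · rw [hQuv, hQuu, hQvv]; linarith
      · rw [hQuv, hQuu, hQvv]; linarith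
      · intro x h1 h2 h3 _
        by_cases hxB : x ∈ B
        · obtain ⟨b1, b2, b3, b4⟩ := hQB x hxB
          rw [b1, b2, b3, b4]; norm_num
        · simp [hQ' x h1 h2 hxB]
      · intro x y h1 h2 h3 h4
        rw [hQ'' x y h1 h2 h3 h4, sub_self]
    have hadd : 0 ≤ foldEntry σ α β (G'.signlessLapMatrix + G.signlessLapMatrix) i j := by
      refine foldEntry_nonneg hinj su sv sR sf sx ?_ zero_le_two ?_ ?_ ?_ ?_ ?_ ?_ huR hfR' hvR huv
        ?_ ?_ ?_ ?_ ?_ i j <;> simp only [Matrix.add_apply]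
      · intro x y
        rw [signlessLapMatrix_comm, signlessLapMatrix_comm G]
      · intro r hr; rw [hQR' r hr, (hQR r hr).1]; norm_num
      · intro r hr; rw [hQR' r hr, (hQR r hr).2.1]; norm_num
      · intro r hr y h1 h2; rw [hQR' r hr, (hQR r hr).2.2 y h1 h2]; norm_num
      · intro r hr; rw [hQf' r hr, (hQf r hr).1]; norm_num
      · intro r hr; rw [hQf' r hr, (hQf r hr).2.1]; norm_num
      · intro r hr y h1 h2; rw [hQf' r hr, (hQf r hr).2.2 y h1 h2]; norm_num
      -- This is 2 d(v) - |B| ≤ 2 d(u) + |B|, a consequence of the degree condition.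
      · rw [hQuu, hQvv]; linarith
      · rw [hQuv, hQuu, hQvv]; linarith
      · linarith [signlessLapMatrix_nonneg G u u, signlessLapMatrix_nonneg G u v,
          signlessLapMatrix_nonneg G v v, signlessLapMatrix_nonneg G' u u,
          signlessLapMatrix_nonneg G' u v, signlessLapMatrix_nonneg G' v v]
      · intro x h1 h2 h3 _
        refine ⟨?_, ?_⟩
        · by_cases hxB : x ∈ B
          · obtain ⟨b1, b2, b3, b4⟩ := hQB x hxB
            rw [b1, b2, b3, b4]; norm_num
          · rw [hQ' x h1 h2 hxB, hQ' x h1 h2 hxB]; linarith [hx x h1 h2 h3 hxB]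
        · linarith [signlessLapMatrix_nonneg G x u, signlessLapMatrix_nonneg G x v,
            signlessLapMatrix_nonneg G' x u, signlessLapMatrix_nonneg G' x v]
      · intro x y _ _ _ _
        linarith [signlessLapMatrix_nonneg G x y, signlessLapMatrix_nonneg G' x y]
    simp only [foldEntry, Matrix.sub_apply, Matrix.add_apply] at hsub hadd ⊢
    rw [abs_le]
    constructor <;> linarith
  -- Only the degrees of `u` and `v` change, and tr(Q²) grows by 2|B|(d(u) + |B| - d(v)) > 0.
  · rw [trace_signlessLapMatrix_sq, trace_signlessLapMatrix_sq]
    set k : ℝ := (B.card : ℝ)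
    have : ∀ x, ((G'.degree x : ℝ) ^ 2 + G'.degree x) = ((G.degree x : ℝ) ^ 2 + G.degree x) +
        (if x = u then 2 * k * G.degree u + k ^ 2 + k else 0) +
        (if x = v then -2 * k * G.degree v + k ^ 2 - k else 0) := by
      intro x
      rw [hdeg]
      by_cases h1 : x = u
      · subst h1; simp only [if_true, if_neg huv]; ring
      · by_cases h2 : x = v
        · subst h2; simp only [if_true, if_neg h1]; ring
        · simp only [if_neg h1, if_neg h2]; ring
    rw [Finset.sum_congr rfl fun x _ => this x]
    simp only [Finset.sum_add_distrib, Finset.sum_ite_eq', Finset.mem_univ, if_true]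
    rw [signlessLapMatrix_apply_self, signlessLapMatrix_apply_self] at hd'
    have := mul_pos (show (0 : ℝ) < k by linarith)
      (show 0 < (G.degree u : ℝ) + k - G.degree v by linarith)
    linarith

end SimpleGraph

/-! ### Improving shifts of unicyclic graphs, and graphs determined by a few labelled vertices. -/

namespace SimpleGraph

variable {V : Type*} [Fintype V] [DecidableEq V] {G : SimpleGraph V} [DecidableRel G.Adj]
  {u v : V} {B : Finset V}

omit [DecidableEq V] in
theorem isUnicyclic_iff :
    G.IsUnicyclic ↔ G.Connected ∧ G.edgeFinset.card = Fintype.card V := by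
  rw [IsUnicyclic, Nat.card_eq_fintype_card, Nat.card_eq_fintype_card, ← edgeFinset_card]

theorem IsUnicyclic.shift (hG : G.IsUnicyclic) (huv : u ≠ v)
    (hB : ∀ b ∈ B, G.Adj v b ∧ ¬ G.Adj u b ∧ b ≠ u)
    (hcon : G.Adj u v ∨ ∃ z, G.Adj u z ∧ G.Adj v z) : (G.shift u v B).IsUnicyclic := by
  rw [isUnicyclic_iff] at hG ⊢
  obtain ⟨hc, he⟩ := hG
  have huB : u ∉ B := fun h => (hB u h).2.2 rfl
  have hvB : v ∉ B := fun h => (hB v h).1.ne rfl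
  -- A common neighbour of `u` and `v` is never moved, so the link between `u` and `v` survives.
  -- Each lost edge v b can then be replaced by a route through `u`. The edge count is kept because
  -- the degree sum is.
  have hreach : (G.shift u v B).Reachable u v := by
    rcases hcon with h | ⟨z, h1, h2⟩
    · exact Adj.reachable (shift_adj.2 ⟨huv, by tauto⟩)
    · have hz : z ∉ B := fun h => (hB z h).2.1 h1
      have a1 : (G.shift u v B).Adj u z := shift_adj.2 ⟨h1.ne, by tauto⟩
      have a2 : (G.shift u v B).Adj z v := shift_adj.2 ⟨h2.ne', Or.inl ⟨h2.symm, by tauto, by tauto⟩⟩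
      exact a1.reachable.trans a2.reachable
  have hb : ∀ b ∈ B, (G.shift u v B).Reachable v b := fun b h =>
    hreach.symm.trans (Adj.reachable (shift_adj.2 ⟨(hB b h).2.2.symm, by tauto⟩))
  have hadj : ∀ x y, G.Adj x y → (G.shift u v B).Reachable x y := by
    intro x y h
    by_cases h1 : x = v ∧ y ∈ B
    · rw [h1.1]; exact hb y h1.2
    · by_cases h2 : y = v ∧ x ∈ B
      · rw [h2.1]; exact (hb x h2.2).symm
      · exact Adj.reachable (shift_adj.2 ⟨h.ne, Or.inl ⟨h, h1, h2⟩⟩)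
  have hwalk : ∀ x y, G.Walk x y → (G.shift u v B).Reachable x y := by
    intro x y p
    induction p with
    | nil => exact Reachable.refl _
    | cons h _ ih => exact (hadj _ _ h).trans ih
  refine ⟨?_, ?_⟩
  · have := hc.nonempty
    exact Connected.mk fun x y => (hc.preconnected x y).elim fun p => hwalk x y p
  · have h1 := G.sum_degrees_eq_twice_card_edges
    have h2 := (G.shift u v B).sum_degrees_eq_twice_card_edges
    have h3 : (∑ x, ((G.shift u v B).degree x : ℝ)) = ∑ x, (G.degree x : ℝ) := by
      rw [Finset.sum_congr rfl fun x _ => degree_shift huv hB x]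
      simp [Finset.sum_add_distrib, Finset.sum_sub_distrib]
    have h4 : ∑ x, (G.shift u v B).degree x = ∑ x, G.degree x := by exact_mod_cast h3
    omega

-- A shift can create a dominating vertex only at `u`: `v` only loses neighbours, each vertex of `B`
-- trades `v` for `u`, and the other neighbourhoods are unchanged.
omit [Fintype V] [DecidableRel G.Adj] in
theorem eq_of_forall_shift_adj (hB : ∀ b ∈ B, G.Adj v b ∧ ¬ G.Adj u b ∧ b ≠ u)
    (hG : ∀ c, ∃ y, y ≠ c ∧ ¬ G.Adj c y) {d : V} (hd : ∀ y, y ≠ d → (G.shift u v B).Adj d y) :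
    d = u := by
  by_contra hdu
  obtain ⟨y, hy, hdy⟩ := hG d
  by_cases hdv : d = v
  · have := (shift_adj.1 (hd y hy)).2
    have h2 : d ∉ B := fun h => (hB d h).1.ne hdv.symm
    tauto
  · by_cases hdB : d ∈ B
    · have := (shift_adj.1 (hd v (Ne.symm hdv))).2
      have h2 : v ∉ B := fun h => (hB v h).1.ne rfl
      have h3 : v ≠ u := by
        rintro rfl
        exact (hB d hdB).2.1 (hB d hdB).1
      tauto
    · have := (shift_adj.1 (hd y hy)).2
      tauto

/-- A vertex shift that leads to a unicyclic graph of larger index without dominating vertex. -/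
theorem IsUnicyclic.exists_slee_lt_of_shift (hG : G.IsUnicyclic)
    (hnd : ∀ c, ∃ y, y ≠ c ∧ ¬ G.Adj c y) (huv : u ≠ v)
    (hcon : G.Adj u v ∨ ∃ z, G.Adj u z ∧ G.Adj v z)
    (hB : ∀ b ∈ B, G.Adj v b ∧ ¬ G.Adj u b ∧ b ≠ u)
    (hne : B.Nonempty) (hd : G.degree v < G.degree u + B.card) {R : Finset V} {f : V → V}
    (hinj : Set.InjOn f R) (hR : ∀ r ∈ R, r ≠ u ∧ r ∉ B ∧ ∀ y, G.Adj r y ↔ y = v)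
    (hfR : ∀ r ∈ R, f r ≠ v ∧ ∀ y, G.Adj (f r) y ↔ y = u)
    (hN : ∀ y, G.Adj v y → y = u ∨ G.Adj u y ∨ y ∈ B ∨ y ∈ R)
    {t : V} (htu : t ≠ u) (ht : ¬ G.Adj u t) (htB : t ∉ B) :
    ∃ (G' : SimpleGraph V) (_ : DecidableRel G'.Adj), G'.IsUnicyclic ∧
      (∀ c, ∃ y, y ≠ c ∧ ¬ G'.Adj c y) ∧ G.slee < G'.slee := by
  refine ⟨G.shift u v B, inferInstance, hG.shift huv hB hcon, fun c => ?_,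
    slee_lt_slee_shift huv hB hne hd hinj hR hfR hN⟩
  by_contra! h
  obtain rfl := eq_of_forall_shift_adj hB hnd h
  have := (shift_adj.1 (h t htu)).2
  have h2 : c ∉ B := fun h => (hB c h).2.2 rfl
  tauto

variable (G) in
/-- The neighbours of `v` outside the closed neighbourhood of `u`. -/
def privateNeighbors (u v : V) : Finset V :=
  Finset.univ.filter fun b => G.Adj v b ∧ ¬ G.Adj u b ∧ b ≠ u

theorem mem_privateNeighbors {b : V} :
    b ∈ G.privateNeighbors u v ↔ G.Adj v b ∧ ¬ G.Adj u b ∧ b ≠ u := by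
  simp [privateNeighbors]

/-- Common neighbours cancel, so d(v) - d(u) is the difference of the numbers of private neighbours.
One private neighbour on the side of `u` makes the inequality strict. This replaces maximality of
d(u) in shifts towards other vertices. -/
theorem degree_lt_degree_add_card_privateNeighbors {a : V} (ha : a ∈ G.privateNeighbors v u) :
    G.degree v < G.degree u + (G.privateNeighbors u v).card := by
  obtain ⟨h1, h2, h3⟩ := mem_privateNeighbors.1 ha
  by_cases huv : u = v
  · subst huv; exact absurd h1 h2
  have hsub : (G.neighborFinset v).erase u ⊆
      ((G.neighborFinset u).erase v).erase a ∪ G.privateNeighbors u v := by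
    intro x hx
    simp only [Finset.mem_erase, mem_neighborFinset, Finset.mem_union, mem_privateNeighbors] at hx ⊢
    have hxv : x ≠ v := hx.2.ne'
    have hxa : x ≠ a := fun h => h2 (h ▸ hx.2)
    tauto
  have hcard := (Finset.card_le_card hsub).trans (Finset.card_union_le _ _)
  have hmem : a ∈ (G.neighborFinset u).erase v := by
    simp [h3, h1]
  have h4 := Finset.card_erase_add_one hmem
  simp only [← card_neighborFinset_eq_degree]
  by_cases h : G.Adj u v
  · have h5 := Finset.card_erase_add_one (show u ∈ G.neighborFinset v by simpa using h.symm)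
    have h6 := Finset.card_erase_add_one (show v ∈ G.neighborFinset u by simpa using h)
    omega
  · rw [Finset.erase_eq_of_notMem (show u ∉ G.neighborFinset v by
      simpa using fun e => h (G.adj_symm e))] at hcard
    rw [Finset.erase_eq_of_notMem (show v ∉ G.neighborFinset u by simpa using h)] at hcard h4
    omega

/-- When all private neighbours of `v` move, nothing remains to be mirrored, so the involution is
the bare exchange of `u` and `v`. The vertex `t`, adjacent to neither, keeps `u` from becoming
dominating. -/
theorem IsUnicyclic.exists_slee_lt_of_privateNeighbors (hG : G.IsUnicyclic)
    (hnd : ∀ c, ∃ y, y ≠ c ∧ ¬ G.Adj c y)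
    (hcon : G.Adj u v ∨ ∃ z, G.Adj u z ∧ G.Adj v z) {b : V} (hb : b ∈ G.privateNeighbors u v)
    (hd : G.degree v < G.degree u + (G.privateNeighbors u v).card)
    {t : V} (htu : t ≠ u) (ht : ¬ G.Adj u t) (htv : ¬ G.Adj v t) :
    ∃ (G' : SimpleGraph V) (_ : DecidableRel G'.Adj), G'.IsUnicyclic ∧
      (∀ c, ∃ y, y ≠ c ∧ ¬ G'.Adj c y) ∧ G.slee < G'.slee := by
  refine hG.exists_slee_lt_of_shift (u := u) (v := v) (B := G.privateNeighbors u v) (R := ∅)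
    (f := id) hnd ?_ hcon (fun b hb => mem_privateNeighbors.1 hb) ⟨b, hb⟩ hd (by simp) (by simp)
    (by simp) ?_ htu ht (fun h => htv (mem_privateNeighbors.1 h).1)
  · rintro rfl
    have := mem_privateNeighbors.1 hb
    exact this.2.1 this.1
  · intro y hy
    have := @mem_privateNeighbors V _ _ G _ u v y
    tauto

/-- A walk from `c` to `y` has a first step out of the closed neighbourhood of `c`. -/
theorem Connected.exists_adj_adj_not_adj {V : Type*} {G : SimpleGraph V} (hG : G.Connected)
    {c y : V} (hy : y ≠ c) (hcy : ¬ G.Adj c y) :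
    ∃ a w, G.Adj c a ∧ G.Adj a w ∧ w ≠ c ∧ ¬ G.Adj c w := by
  obtain ⟨p⟩ := hG.preconnected c y
  obtain ⟨d, -, h1, h2⟩ := p.exists_boundary_dart {z | z = c ∨ G.Adj c z} (Or.inl rfl)
    (by simp [hy, hcy])
  simp only [Set.mem_ofPred_eq, not_or] at h1 h2
  refine ⟨d.fst, d.snd, h1.resolve_left fun h => ?_, d.adj, h2.1, h2.2⟩
  exact h2.2 (h ▸ d.adj)

/-- For `c` of maximum degree the degree condition is automatic, and a vertex at distance two from
`c` provides a neighbour `a` of `c` with something to move. -/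
theorem IsUnicyclic.exists_slee_lt (hG : G.IsUnicyclic) (hnd : ∀ c, ∃ y, y ≠ c ∧ ¬ G.Adj c y) :
    ∃ (G' : SimpleGraph V) (_ : DecidableRel G'.Adj), G'.IsUnicyclic ∧ G.slee < G'.slee := by
  have := hG.1.nonempty
  obtain ⟨c, hc⟩ := G.exists_maximal_degree_vertex
  obtain ⟨y, hy, hcy⟩ := hnd c
  obtain ⟨a, w, h1, h2, h3, h4⟩ := hG.1.exists_adj_adj_not_adj hy hcy
  have hw : w ∈ G.privateNeighbors c a := mem_privateNeighbors.2 ⟨h2, h4, h3⟩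
  refine ⟨G.shift c a (G.privateNeighbors c a), inferInstance,
    hG.shift h1.ne (fun b hb => mem_privateNeighbors.1 hb) (Or.inl h1),
    slee_lt_slee_shift (R := ∅) (f := id) h1.ne (fun b hb => mem_privateNeighbors.1 hb)
      ⟨w, hw⟩ ?_ (by simp) (by simp) (by simp) ?_⟩
  · have := Finset.card_pos.2 ⟨w, hw⟩
    have := G.degree_le_maxDegree a
    omega
  · intro z hz
    have := @mem_privateNeighbors V _ _ G _ c a z
    tauto

theorem card_edgeFinset_sdiff_incidenceFinset (c : V) :
    (G.edgeFinset \ G.incidenceFinset c).card + G.degree c = G.edgeFinset.card := by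
  have := Finset.card_sdiff_add_card_eq_card (G.incidenceFinset_subset c)
  rwa [card_incidenceFinset_eq_degree] at this

theorem mem_edgeFinset_sdiff_incidenceFinset {c p q : V} :
    s(p, q) ∈ G.edgeFinset \ G.incidenceFinset c ↔ G.Adj p q ∧ p ≠ c ∧ q ≠ c := by
  simp only [Finset.mem_sdiff, mem_edgeFinset, mem_edgeSet, mem_incidenceFinset,
    mk'_mem_incidenceSet_iff]
  constructor
  · rintro ⟨h, h'⟩
    exact ⟨h, fun e => h' ⟨h, Or.inl e.symm⟩, fun e => h' ⟨h, Or.inr e.symm⟩⟩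
  · rintro ⟨h, h1, h2⟩
    exact ⟨h, fun ⟨_, h'⟩ => h'.elim (fun e => h1 e.symm) (fun e => h2 e.symm)⟩

/-- Of the n edges, n - 1 are at `c`, so exactly one edge avoids `c`. -/
theorem IsUnicyclic.adj_iff_of_dominating (hG : G.IsUnicyclic) {c : V}
    (hc : ∀ y, y ≠ c → G.Adj c y) : ∃ x y, x ≠ c ∧ y ≠ c ∧ x ≠ y ∧
      ∀ p q, G.Adj p q ↔ p ≠ q ∧ (p = c ∨ q = c ∨ s(p, q) = s(x, y)) := by
  have hdeg : G.degree c + 1 = Fintype.card V := by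
    rw [← card_neighborFinset_eq_degree]
    have : G.neighborFinset c = Finset.univ.erase c := by
      ext z
      simp only [mem_neighborFinset, Finset.mem_erase, Finset.mem_univ, and_true]
      exact ⟨fun h => h.ne', hc z⟩
    rw [this, Finset.card_erase_add_one (Finset.mem_univ c), Finset.card_univ]
  have h1 := G.card_edgeFinset_sdiff_incidenceFinset c
  have h2 := (isUnicyclic_iff.1 hG).2
  obtain ⟨e, he⟩ := Finset.card_eq_one.1
    (show (G.edgeFinset \ G.incidenceFinset c).card = 1 by omega)
  induction e using Sym2.ind with
  | _ x y =>
    have hmem : ∀ p q, G.Adj p q ∧ p ≠ c ∧ q ≠ c ↔ s(p, q) = s(x, y) := fun p q => by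
      rw [← mem_edgeFinset_sdiff_incidenceFinset, he, Finset.mem_singleton]
    obtain ⟨a1, a2, a3⟩ := (hmem x y).2 rfl
    refine ⟨x, y, a2, a3, a1.ne, fun p q => ?_⟩
    rw [← hmem]
    constructor
    · intro h
      refine ⟨h.ne, ?_⟩
      tauto
    · rintro ⟨h, rfl | rfl | h'⟩
      · exact hc q h.symm
      · exact (hc p h).symm
      · exact h'.1

theorem exists_equiv_apply_eq {V W ι : Type*} [Fintype V] [Fintype W]
    (hcard : Fintype.card V = Fintype.card W) {f : ι → V} {g : ι → W}
    (hf : Function.Injective f) (hg : Function.Injective g) : ∃ e : V ≃ W, ∀ i, e (f i) = g i := by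
  classical
  let e₀ : V ≃ W := Fintype.equivOfCardEq hcard
  have hf' : Function.Injective (e₀ ∘ f) := e₀.injective.comp hf
  let s : {w // w ∈ Set.range (e₀ ∘ f)} ≃ {w // w ∈ Set.range g} :=
    (Equiv.ofInjective _ hf').symm.trans (Equiv.ofInjective _ hg)
  refine ⟨e₀.trans s.extendSubtype, fun i => ?_⟩
  rw [Equiv.trans_apply, Equiv.extendSubtype_apply_of_mem s (e₀ (f i)) ⟨i, rfl⟩]
  have h : s ⟨e₀ (f i), ⟨i, rfl⟩⟩ = Equiv.ofInjective g hg i :=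
    congrArg (Equiv.ofInjective g hg) ((Equiv.ofInjective _ hf').symm_apply_apply i)
  rw [h, Equiv.ofInjective_apply]

theorem nonempty_iso_of_dominating {V W : Type*} [Fintype V] [Fintype W]
    (hcard : Fintype.card V = Fintype.card W) {G : SimpleGraph V} {H : SimpleGraph W}
    {c x y : V} (hx : x ≠ c) (hy : y ≠ c) (hxy : x ≠ y)
    (hG : ∀ p q, G.Adj p q ↔ p ≠ q ∧ (p = c ∨ q = c ∨ s(p, q) = s(x, y)))
    {c' x' y' : W} (hx' : x' ≠ c') (hy' : y' ≠ c') (hxy' : x' ≠ y')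
    (hH : ∀ p q, H.Adj p q ↔ p ≠ q ∧ (p = c' ∨ q = c' ∨ s(p, q) = s(x', y'))) :
    Nonempty (G ≃g H) := by
  have hf : Function.Injective ![c, x, y] := by
    intro i j; fin_cases i <;> fin_cases j <;> simp [*, hx.symm, hy.symm, hxy.symm]
  have hg : Function.Injective ![c', x', y'] := by
    intro i j; fin_cases i <;> fin_cases j <;> simp [*, hx'.symm, hy'.symm, hxy'.symm]
  obtain ⟨e, he⟩ := exists_equiv_apply_eq hcard hf hg
  have h0 : e c = c' := he 0
  have h1 : e x = x' := he 1
  have h2 : e y = y' := he 2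
  refine ⟨⟨e, fun {p q} => ?_⟩⟩
  rw [hG, hH, ← h0, ← h1, ← h2]
  simp

/-- The pattern of G⁽²⁾: `t 0` is the centre, `t 0`, `t 1`, `t 2` form the triangle, and `t 3` is
the pendant vertex at `t 1`. Any bijection matching these labels is an isomorphism. -/
theorem nonempty_iso_of_almost_dominating {V W : Type*} [Fintype V] [Fintype W]
    (hcard : Fintype.card V = Fintype.card W) {G : SimpleGraph V} {H : SimpleGraph W}
    {t : Fin 4 → V} (ht : Function.Injective t)
    (hG : ∀ p q, G.Adj p q ↔ p ≠ q ∧ ((p = t 0 ∧ q ≠ t 3) ∨ (q = t 0 ∧ p ≠ t 3) ∨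
      s(p, q) = s(t 1, t 2) ∨ s(p, q) = s(t 1, t 3)))
    {t' : Fin 4 → W} (ht' : Function.Injective t')
    (hH : ∀ p q, H.Adj p q ↔ p ≠ q ∧ ((p = t' 0 ∧ q ≠ t' 3) ∨ (q = t' 0 ∧ p ≠ t' 3) ∨
      s(p, q) = s(t' 1, t' 2) ∨ s(p, q) = s(t' 1, t' 3))) :
    Nonempty (G ≃g H) := by
  obtain ⟨e, he⟩ := exists_equiv_apply_eq hcard ht ht'
  refine ⟨⟨e, fun {p q} => ?_⟩⟩
  rw [hG, hH, ← he 0, ← he 1, ← he 2, ← he 3]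
  simp

end SimpleGraph

namespace SimpleGraph

variable {V : Type*} [Fintype V] [DecidableEq V] {G : SimpleGraph V} [DecidableRel G.Adj]

/-- Let `c` be a vertex such that every vertex outside its closed neighbourhood is adjacent to
`a`. In a unicyclic graph, exactly one edge lies neither at `c` nor between `a` and the outside. -/
theorem IsUnicyclic.exists_adj_iff_of_forall_adj (hG : G.IsUnicyclic) {c a : V} (hca : G.Adj c a)
    (haW : ∀ w, w ≠ c → ¬ G.Adj c w → G.Adj a w) :
    ∃ x y, x ≠ c ∧ y ≠ c ∧ G.Adj x y ∧ ¬ (x = a ∧ ¬ G.Adj c y) ∧ ¬ (y = a ∧ ¬ G.Adj c x) ∧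
      ∀ p q, p ≠ c → q ≠ c → (G.Adj p q ↔
        (p = a ∧ ¬ G.Adj c q) ∨ (q = a ∧ ¬ G.Adj c p) ∨ s(p, q) = s(x, y)) := by
  set W : Finset V := Finset.univ.filter fun w => w ≠ c ∧ ¬ G.Adj c w with hW
  have hmW : ∀ w, w ∈ W ↔ w ≠ c ∧ ¬ G.Adj c w := fun w => by simp [hW]
  have hWcard : W.card + G.degree c + 1 = Fintype.card V := by
    have : W = Finset.univ \ insert c (G.neighborFinset c) := by
      ext w; simp [hmW]
    have hc : c ∉ G.neighborFinset c := by simp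
    rw [this, add_assoc, ← card_neighborFinset_eq_degree, ← Finset.card_insert_of_notMem hc,
      Finset.card_sdiff_add_card_eq_card (Finset.subset_univ _), Finset.card_univ]
  have hsub : W.image (fun w => s(a, w)) ⊆ G.edgeFinset \ G.incidenceFinset c := by
    intro e he
    obtain ⟨w, hw, rfl⟩ := Finset.mem_image.1 he
    obtain ⟨h1, h2⟩ := (hmW w).1 hw
    exact mem_edgeFinset_sdiff_incidenceFinset.2 ⟨haW w h1 h2, hca.ne', h1⟩
  have himg : (W.image fun w => s(a, w)).card = W.card :=
    Finset.card_image_of_injective _ fun w w' h => Sym2.congr_right.1 h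
  have h1 := G.card_edgeFinset_sdiff_incidenceFinset c
  have h2 := (isUnicyclic_iff.1 hG).2
  have h3 := Finset.card_sdiff_add_card_eq_card hsub
  -- There are n - d(c) edges avoiding `c`, and n - 1 - d(c) of them join `a` to the outside.
  obtain ⟨e, he⟩ := Finset.card_eq_one.1
    (show ((G.edgeFinset \ G.incidenceFinset c) \ W.image fun w => s(a, w)).card = 1 by omega)
  have himem : ∀ p q, p ≠ c → q ≠ c → (s(p, q) ∈ W.image (fun w => s(a, w)) ↔
      (p = a ∧ ¬ G.Adj c q) ∨ (q = a ∧ ¬ G.Adj c p)) := by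
    intro p q hp hq
    simp only [Finset.mem_image, hmW, Sym2.eq_iff]
    constructor
    · rintro ⟨w, ⟨_, hw⟩, ⟨rfl, rfl⟩ | ⟨rfl, rfl⟩⟩ <;> tauto
    · rintro (⟨rfl, h⟩ | ⟨rfl, h⟩)
      · exact ⟨q, ⟨hq, h⟩, Or.inl ⟨rfl, rfl⟩⟩
      · exact ⟨p, ⟨hp, h⟩, Or.inr ⟨rfl, rfl⟩⟩
  induction e using Sym2.ind with
  | _ x y =>
    have hmem : ∀ p q, p ≠ c → q ≠ c →
        (G.Adj p q ∧ ¬ ((p = a ∧ ¬ G.Adj c q) ∨ (q = a ∧ ¬ G.Adj c p)) ↔ s(p, q) = s(x, y)) := by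
      intro p q hp hq
      rw [← himem p q hp hq, ← Finset.mem_singleton, ← he, Finset.mem_sdiff,
        mem_edgeFinset_sdiff_incidenceFinset]
      tauto
    have hxy : s(x, y) ∈ G.edgeFinset \ G.incidenceFinset c := by
      have : s(x, y) ∈ (G.edgeFinset \ G.incidenceFinset c) \ W.image fun w => s(a, w) := by
        rw [he]; exact Finset.mem_singleton_self _
      exact (Finset.mem_sdiff.1 this).1
    obtain ⟨b1, b2, b3⟩ := mem_edgeFinset_sdiff_incidenceFinset.1 hxy
    have b4 := ((hmem x y b2 b3).2 rfl).2
    refine ⟨x, y, b2, b3, b1, fun h => b4 (Or.inl h), fun h => b4 (Or.inr h), fun p q hp hq => ?_⟩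
    rw [← hmem p q hp hq]
    constructor
    · tauto
    · rintro (⟨rfl, h⟩ | ⟨rfl, h⟩ | h)
      · exact haW q hq h
      · exact (haW p hp h).symm
      · exact h.1

/-- In a triangle `c a y` with all other vertices pendant at `c` or `a`, at least two of them at
`a` and not more than at `c`, moving one pendant vertex from `a` to `c` increases the index. -/
theorem IsUnicyclic.exists_slee_lt_of_triangle (hG : G.IsUnicyclic)
    (hnd : ∀ c, ∃ y, y ≠ c ∧ ¬ G.Adj c y) {c a y : V} (hca : G.Adj c a) (hcy : G.Adj c y)
    (hay : G.Adj a y)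
    (hadj : ∀ p q, p ≠ c → q ≠ c → (G.Adj p q ↔
        (p = a ∧ ¬ G.Adj c q) ∨ (q = a ∧ ¬ G.Adj c p) ∨ s(p, q) = s(a, y)))
    (hdeg : G.degree a ≤ G.degree c) {w w' : V} (hww : w ≠ w') (hwc : w ≠ c) (hcw : ¬ G.Adj c w)
    (hwc' : w' ≠ c) (hcw' : ¬ G.Adj c w') :
    ∃ (G' : SimpleGraph V) (_ : DecidableRel G'.Adj), G'.IsUnicyclic ∧
      (∀ c, ∃ y, y ≠ c ∧ ¬ G'.Adj c y) ∧ G.slee < G'.slee := by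
  set W : Finset V := Finset.univ.filter fun w => w ≠ c ∧ ¬ G.Adj c w with hW
  have hmW : ∀ w, w ∈ W ↔ w ≠ c ∧ ¬ G.Adj c w := fun w => by simp [hW]
  set P : Finset V := ((G.neighborFinset c).erase a).erase y with hP
  have hmP : ∀ z, z ∈ P ↔ z ≠ y ∧ z ≠ a ∧ G.Adj c z := fun z => by simp [hP]
  have hPcard : P.card + 2 = G.degree c := by
    have h1 : a ∈ G.neighborFinset c := by simpa using hca
    have h2 : y ∈ (G.neighborFinset c).erase a := by simp [hay.ne', hcy]
    have := Finset.card_erase_add_one h1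
    have := Finset.card_erase_add_one h2
    rw [hP, ← card_neighborFinset_eq_degree]
    omega
  have hNa : ∀ z, G.Adj a z ↔ z = c ∨ z = y ∨ z ∈ W := by
    intro z
    rw [hmW]
    by_cases hz : z = c
    · subst hz; simp [hca.symm]
    · rw [hadj a z hca.ne' hz]
      simp only [Sym2.eq_iff]
      have := hay.ne
      tauto
  have hWcard : W.card + 2 = G.degree a := by
    have : G.neighborFinset a = insert c (insert y W) := by
      ext z; simp [hNa]
    have h1 : y ∉ W := fun h => ((hmW y).1 h).2 hcy
    have h2 : c ∉ insert y W := by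
      simp [hcy.ne, hmW]
    rw [← card_neighborFinset_eq_degree, this, Finset.card_insert_of_notMem h2,
      Finset.card_insert_of_notMem h1]
  have hwW : w ∈ W := (hmW w).2 ⟨hwc, hcw⟩
  have hWc := Finset.card_erase_add_one hwW
  -- Since d(a) ≤ d(c), there are enough pendant vertices at `c` to mirror those that stay at `a`.
  have hemb : Nonempty (W.erase w ↪ P) := by
    refine Function.Embedding.nonempty_of_card_le ?_
    rw [Fintype.card_coe, Fintype.card_coe]
    omega
  obtain ⟨g⟩ := hemb
  have hgf : ∀ r (hr : r ∈ W.erase w), (if h : r ∈ W.erase w then (g ⟨r, h⟩ : V) else r) =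
      g ⟨r, hr⟩ := fun r hr => dif_pos hr
  -- Only `w` moves. The second pendant vertex `w'` stays at `a` and prevents `c` from becoming
  -- dominating.
  refine hG.exists_slee_lt_of_shift (u := c) (v := a) (B := {w}) (R := W.erase w)
    (f := fun z => if h : z ∈ W.erase w then (g ⟨z, h⟩ : V) else z)
    hnd hca.ne (Or.inl hca) ?_ (Finset.singleton_nonempty w) ?_ ?_ ?_ ?_ ?_ hwc' hcw' ?_
  · intro b hb
    rw [Finset.mem_singleton.1 hb]
    exact ⟨(hNa w).2 (Or.inr (Or.inr hwW)), hcw, hwc⟩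
  · rw [Finset.card_singleton]; omega
  · intro r hr s hs h
    have hr' := Finset.mem_coe.1 hr
    have hs' := Finset.mem_coe.1 hs
    simp only [hgf r hr', hgf s hs'] at h
    have := g.injective (Subtype.ext h)
    simpa using this
  · intro r hr
    obtain ⟨h1, h2⟩ := Finset.mem_erase.1 hr
    obtain ⟨h3, h4⟩ := (hmW r).1 h2
    refine ⟨h3, by simpa using h1, fun z => ?_⟩
    by_cases hz : z = c
    · subst hz
      exact ⟨fun h => absurd h.symm h4, fun h => absurd h hca.ne⟩
    · rw [hadj r z h3 hz, Sym2.eq_iff]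
      have h5 : r ≠ a := fun h => h4 (h ▸ hca)
      have h6 : r ≠ y := fun h => h4 (h ▸ hcy)
      tauto
  · intro r hr
    simp only [hgf r hr]
    obtain ⟨h1, h2, h3⟩ := (hmP _).1 (g ⟨r, hr⟩).2
    refine ⟨h2, fun z => ?_⟩
    by_cases hz : z = c
    · subst hz
      exact ⟨fun _ => rfl, fun _ => h3.symm⟩
    · rw [hadj _ z h3.ne' hz, Sym2.eq_iff]
      tauto
  · intro z hz
    rcases (hNa z).1 hz with h | rfl | h
    · exact Or.inl h
    · exact Or.inr (Or.inl hcy)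
    · by_cases hzw : z = w
      · exact Or.inr (Or.inr (Or.inl (by simp [hzw])))
      · exact Or.inr (Or.inr (Or.inr (Finset.mem_erase.2 ⟨hzw, h⟩)))
  · simpa using hww.symm

theorem IsUnicyclic.exists_slee_lt_or_adj_iff (hG : G.IsUnicyclic)
    (hcard : 5 ≤ Fintype.card V) (hnd : ∀ c, ∃ y, y ≠ c ∧ ¬ G.Adj c y) :
    (∃ (G' : SimpleGraph V) (_ : DecidableRel G'.Adj), G'.IsUnicyclic ∧
      (∀ c, ∃ y, y ≠ c ∧ ¬ G'.Adj c y) ∧ G.slee < G'.slee) ∨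
    ∃ t : Fin 4 → V, Function.Injective t ∧
      ∀ p q, G.Adj p q ↔ p ≠ q ∧ ((p = t 0 ∧ q ≠ t 3) ∨ (q = t 0 ∧ p ≠ t 3) ∨
        s(p, q) = s(t 1, t 2) ∨ s(p, q) = s(t 1, t 3)) := by
  rw [or_iff_not_imp_left]
  intro hno
  have := hG.1.nonempty
  obtain ⟨c, hc⟩ := G.exists_maximal_degree_vertex
  have hmax : ∀ v, G.degree v ≤ G.degree c := fun v => hc ▸ G.degree_le_maxDegree v
  obtain ⟨y₀, hy₀, hcy₀⟩ := hnd c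
  obtain ⟨a, w₀, hca, haw, hw₀c, hcw₀⟩ := hG.1.exists_adj_adj_not_adj hy₀ hcy₀
  have hlt : ∀ {v b}, b ∈ G.privateNeighbors c v →
      G.degree v < G.degree c + (G.privateNeighbors c v).card := fun {v b} hb => by
    have := Finset.card_pos.2 ⟨b, hb⟩
    have := hmax v
    omega
  -- If `b` missed an outside vertex `y`, its private neighbours could be shifted to `c` while `y`
  -- stays a non-neighbour of `c`.
  have hout : ∀ b, G.Adj c b → ∀ w, w ≠ c → ¬ G.Adj c w → G.Adj b w →
      ∀ y, y ≠ c → ¬ G.Adj c y → G.Adj b y := by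
    intro b hcb w hw hcw hbw y hy hcy
    by_contra hby
    have hmem : w ∈ G.privateNeighbors c b := mem_privateNeighbors.2 ⟨hbw, hcw, hw⟩
    exact hno (hG.exists_slee_lt_of_privateNeighbors hnd (Or.inl hcb) hmem (hlt hmem) hy hcy hby)
  have haW := hout a hca w₀ hw₀c hcw₀ haw
  -- An outside neighbour of `w` could be shifted to `c`: `a` is a common neighbour of `c` and `w`,
  -- and `w` itself stays a non-neighbour of `c`.
  have hin : ∀ w, w ≠ c → ¬ G.Adj c w → ∀ z, G.Adj w z → G.Adj c z := by
    intro w hw hcw z hwz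
    by_contra hcz
    have hzc : z ≠ c := by rintro rfl; exact hcw hwz.symm
    have hmem : z ∈ G.privateNeighbors c w := mem_privateNeighbors.2 ⟨hwz, hcz, hzc⟩
    exact hno (hG.exists_slee_lt_of_privateNeighbors hnd (Or.inr ⟨a, hca, (haW w hw hcw).symm⟩)
      hmem (hlt hmem) hw hcw G.irrefl)
  obtain ⟨x, y, hxc, hyc, hxy, hx, hy, hadj⟩ := hG.exists_adj_iff_of_forall_adj hca haW
  -- Otherwise `c`, `a`, `x`, `y` form a 4-cycle and `x` is the only outside vertex. Shifting from
  -- `x` to `a` moves `y` and turns the 4-cycle into a triangle. A fifth vertex, which exists as n ≥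
  -- 5 and is adjacent to `c` but not to `a`, keeps `a` from dominating.
  have hinner : ∀ x y, x ≠ c → y ≠ c → G.Adj x y → ¬ (y = a ∧ ¬ G.Adj c x) →
      (∀ p q, p ≠ c → q ≠ c → (G.Adj p q ↔
        (p = a ∧ ¬ G.Adj c q) ∨ (q = a ∧ ¬ G.Adj c p) ∨ s(p, q) = s(x, y))) → G.Adj c x := by
    intro x y hxc hyc hxy hy hadj
    by_contra hcx
    have hcy : G.Adj c y := hin x hxc hcx y hxy
    have hya : y ≠ a := fun h => hy ⟨h, hcx⟩
    have hxa : x ≠ a := fun h => hcx (h ▸ hca)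
    have hax : G.Adj a x := haW x hxc hcx
    have hW : ∀ w, w ≠ c → ¬ G.Adj c w → w = x := by
      intro w hw hcw
      have h := (hadj y w hyc hw).1 (hout y hcy x hxc hcx hxy.symm w hw hcw)
      have h1 : w ≠ a := fun h => hcw (h ▸ hca)
      have h2 : w ≠ y := fun h => hcw (h ▸ hcy)
      rw [Sym2.eq_iff] at h
      rcases h with h | h | h | h
      · exact absurd h.1 hya
      · exact absurd h.1 h1
      · exact absurd h.2 h2
      · exact h.2
    have hmem : c ∈ G.privateNeighbors x a :=
      mem_privateNeighbors.2 ⟨hca.symm, fun h => hcx h.symm, hxc.symm⟩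
    have hmem' : y ∈ G.privateNeighbors a x := by
      refine mem_privateNeighbors.2 ⟨hxy, fun h => ?_, hya⟩
      have h := (hadj a y hca.ne' hyc).1 h
      rw [Sym2.eq_iff] at h
      rcases h with h | h | h | h
      · exact h.2 hcy
      · exact hya h.1
      · exact hxa h.1.symm
      · exact hya h.1.symm
    obtain ⟨z, hz⟩ : ∃ z, z ∉ ({c, a, x, y} : Finset V) := by
      by_contra! h
      have h1 := Finset.card_le_card (fun z _ => h z : Finset.univ ⊆ ({c, a, x, y} : Finset V))
      have h2 : ({c, a, x, y} : Finset V).card ≤ 4 := Finset.card_le_four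
      rw [Finset.card_univ] at h1
      omega
    simp only [Finset.mem_insert, Finset.mem_singleton, not_or] at hz
    obtain ⟨z1, z2, z3, z4⟩ := hz
    have hcz : G.Adj c z := by
      by_contra h
      exact z3 (hW z z1 h)
    refine hno (hG.exists_slee_lt_of_privateNeighbors hnd (Or.inl hax) hmem'
      (degree_lt_degree_add_card_privateNeighbors hmem) z2 ?_ ?_)
    · rw [hadj a z hca.ne' z1, Sym2.eq_iff]
      rintro (h | h | h | h)
      exacts [h.2 hcz, z2 h.1, z4 h.2, z3 h.2]
    · rw [hadj x z hxc z1, Sym2.eq_iff]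
      rintro (h | h | h | h)
      exacts [hxa h.1, z2 h.1, z4 h.2, z3 h.2]
  have hcx : G.Adj c x := hinner x y hxc hyc hxy hy hadj
  have hcy : G.Adj c y := by
    refine hinner y x hyc hxc hxy.symm hx fun p q hp hq => ?_
    rw [hadj p q hp hq, Sym2.eq_swap (a := x)]
  -- Otherwise the triangle is `c`, `x`, `y`, away from `a`. Shifting from `x` to `a` moves `y`, and
  -- `x` remains a non-neighbour of `a`.
  have haxy : a = x ∨ a = y := by
    by_contra! h
    obtain ⟨hax, hay⟩ := h
    have hmem : w₀ ∈ G.privateNeighbors x a := by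
      refine mem_privateNeighbors.2 ⟨haw, ?_, fun h => hcw₀ (h ▸ hcx)⟩
      rw [hadj x w₀ hxc hw₀c, Sym2.eq_iff]
      rintro (h | h | h | h)
      exacts [hax h.1.symm, hcw₀ (h.1 ▸ hca), hcw₀ (h.2 ▸ hcy), hcw₀ (h.2 ▸ hcx)]
    have hnadj : ∀ z, G.Adj c z → z ≠ c → ¬ G.Adj a z := by
      intro z hz hzc
      rw [hadj a z hca.ne' hzc, Sym2.eq_iff]
      rintro (h | h | h | h)
      exacts [h.2 hz, h.2 hca, hax h.1, hay h.1]
    have hmem' : y ∈ G.privateNeighbors a x :=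
      mem_privateNeighbors.2 ⟨hxy, hnadj y hcy hyc, hay.symm⟩
    exact hno (hG.exists_slee_lt_of_privateNeighbors hnd (Or.inr ⟨c, hca.symm, hcx.symm⟩) hmem'
      (degree_lt_degree_add_card_privateNeighbors hmem) hax.symm (hnadj x hcx hxc) G.irrefl)
  obtain ⟨b, hcb, hbc, hab, hadj'⟩ : ∃ b, G.Adj c b ∧ b ≠ c ∧ G.Adj a b ∧
      ∀ p q, p ≠ c → q ≠ c → (G.Adj p q ↔
        (p = a ∧ ¬ G.Adj c q) ∨ (q = a ∧ ¬ G.Adj c p) ∨ s(p, q) = s(a, b)) := by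
    rcases haxy with rfl | rfl
    · exact ⟨y, hcy, hyc, hxy, hadj⟩
    · refine ⟨x, hcx, hxc, hxy.symm, fun p q hp hq => ?_⟩
      rw [hadj p q hp hq, Sym2.eq_swap (a := x)]
  -- Two outside vertices would be two pendant vertices at `a`, and one of them could be moved to
  -- `c`.
  have hW : ∀ w, w ≠ c → ¬ G.Adj c w → w = w₀ := by
    intro w hw hcw
    by_contra hne
    exact hno (hG.exists_slee_lt_of_triangle hnd hca hcb hab hadj' (hmax a) hne hw hcw hw₀c hcw₀)
  have hc' : ∀ z, z ≠ c → (G.Adj c z ↔ z ≠ w₀) := fun z hz =>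
    ⟨fun h e => hcw₀ (e ▸ h), fun h => by_contra fun h' => h (hW z hz h')⟩
  have hwa : w₀ ≠ a := haw.ne'
  have hwb : w₀ ≠ b := fun h => hcw₀ (h ▸ hcb)
  have hac := hca.ne'
  have hba := hab.ne'
  clear hno hmax hlt hnd hout haW hin hadj hinner hW
  refine ⟨![c, a, b, w₀], ?_, fun p q => ?_⟩
  · intro i j
    fin_cases i <;> fin_cases j <;>
      simp [hac, hac.symm, hba, hba.symm, hwa, hwa.symm, hwb, hwb.symm, hbc, hbc.symm, hw₀c,
        hw₀c.symm]
  · simp only [Matrix.cons_val, Sym2.eq_iff]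
    by_cases hp : p = c
    · subst hp
      by_cases hq : q = p
      · simp [hq]
      · rw [hc' q hq]
        simp [hq, Ne.symm hq, hac.symm, hbc.symm, hw₀c.symm]
    · by_cases hq : q = c
      · subst hq
        rw [G.adj_comm, hc' p hp]
        simp [hp, hac.symm, hbc.symm, hw₀c.symm]
      · rw [hadj' p q hp hq, hc' p hp, hc' q hq, Sym2.eq_iff]
        simp only [hp, hq, false_and, false_or, ne_eq, not_not]
        constructor
        · rintro (⟨rfl, rfl⟩ | ⟨rfl, rfl⟩ | ⟨rfl, rfl⟩ | ⟨rfl, rfl⟩)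
          · exact ⟨hwa.symm, Or.inr (Or.inl ⟨rfl, rfl⟩)⟩
          · exact ⟨hwa, Or.inr (Or.inr ⟨rfl, rfl⟩)⟩
          · exact ⟨hba.symm, Or.inl (Or.inl ⟨rfl, rfl⟩)⟩
          · exact ⟨hba, Or.inl (Or.inr ⟨rfl, rfl⟩)⟩
        · rintro ⟨-, (h | h) | h | h⟩
          · exact Or.inr (Or.inr (Or.inl h))
          · exact Or.inr (Or.inr (Or.inr h))
          · exact Or.inl h
          · exact Or.inr (Or.inl h.symm)

end SimpleGraph

/-! ### The extremal graphs and the two maxima. -/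

namespace SimpleGraph

theorem cycleGraph_three_adj (i j : Fin 3) : (cycleGraph 3).Adj i j ↔ i ≠ j := by
  revert i j; decide

theorem connected_cyclePendant_three (m : Fin 3 → ℕ) : (cyclePendant 3 m).Connected := by
  have h0 : ∀ i, (cyclePendant 3 m).Reachable (Sum.inl i) (Sum.inl 0) := by
    intro i
    by_cases h : i = 0
    · rw [h]
    · exact Adj.reachable ((cycleGraph_three_adj i 0).2 h)
  have h1 : ∀ x, (cyclePendant 3 m).Reachable x (Sum.inl 0) := by
    rintro (i | ⟨i, k⟩)
    · exact h0 i
    · have : (cyclePendant 3 m).Adj (Sum.inr ⟨i, k⟩) (Sum.inl i) := rfl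
      exact this.reachable.trans (h0 i)
  have : Nonempty (Fin 3 ⊕ Σ i : Fin 3, Fin (m i)) := ⟨Sum.inl 0⟩
  exact Connected.mk fun x y => (h1 x).trans (h1 y).symm

theorem isUnicyclic_cyclePendant_three (m : Fin 3 → ℕ) : (cyclePendant 3 m).IsUnicyclic := by
  rw [isUnicyclic_iff]
  refine ⟨connected_cyclePendant_three m, ?_⟩
  have h := (cyclePendant 3 m).sum_degrees_eq_twice_card_edges
  have hdeg : ∀ x, (cyclePendant 3 m).degree x =
      ∑ y, if (cyclePendant 3 m).Adj x y then 1 else 0 := by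
    intro x
    rw [← card_neighborFinset_eq_degree, neighborFinset_eq_filter, Finset.card_filter]
  have hll : ∀ i j, (cyclePendant 3 m).Adj (Sum.inl i) (Sum.inl j) ↔ i ≠ j := cycleGraph_three_adj
  have hlr : ∀ i p, (cyclePendant 3 m).Adj (Sum.inl i) (Sum.inr p) ↔ p.1 = i := fun _ _ => Iff.rfl
  have hrl : ∀ i p, (cyclePendant 3 m).Adj (Sum.inr p) (Sum.inl i) ↔ p.1 = i := fun _ _ => Iff.rfl
  have hrr : ∀ p q, (cyclePendant 3 m).Adj (Sum.inr p) (Sum.inr q) ↔ False := fun _ _ => Iff.rfl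
  simp only [hdeg, Fintype.sum_sum_type, Fintype.sum_sigma, hll, hlr, hrl, hrr, Fin.sum_univ_three]
    at h
  simp at h
  simp [Fin.sum_univ_three]
  omega

theorem cyclePendant_three_adj_iff {m : Fin 3 → ℕ} (h1 : m 1 = 0) (h2 : m 2 = 0)
    (p q : Fin 3 ⊕ Σ i : Fin 3, Fin (m i)) : (cyclePendant 3 m).Adj p q ↔
      p ≠ q ∧ (p = Sum.inl 0 ∨ q = Sum.inl 0 ∨ s(p, q) = s(Sum.inl 1, Sum.inl 2)) := by
  have hm : ∀ r : Σ i : Fin 3, Fin (m i), r.1 = 0 := by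
    rintro ⟨i, k⟩
    fin_cases i
    · rfl
    · exact (Fin.cast h1 k).elim0
    · exact (Fin.cast h2 k).elim0
  rcases p with i | p <;> rcases q with j | q
  · have : (cyclePendant 3 m).Adj (Sum.inl i) (Sum.inl j) ↔ i ≠ j := cycleGraph_three_adj i j
    rw [this]
    simp only [Sym2.eq_iff, ne_eq, Sum.inl.injEq]
    clear this
    revert i j; decide
  · have : (cyclePendant 3 m).Adj (Sum.inl i) (Sum.inr q) ↔ q.1 = i := Iff.rfl
    rw [this, hm]
    simp [eq_comm]
  · have : (cyclePendant 3 m).Adj (Sum.inr p) (Sum.inl j) ↔ p.1 = j := Iff.rfl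
    rw [this, hm]
    simp [eq_comm]
  · have : (cyclePendant 3 m).Adj (Sum.inr p) (Sum.inr q) ↔ False := Iff.rfl
    rw [this]
    simp

theorem cyclePendant_three_exists_adj_iff {m : Fin 3 → ℕ} (h1 : m 1 = 1) (h2 : m 2 = 0) :
    ∃ t : Fin 4 → Fin 3 ⊕ Σ i : Fin 3, Fin (m i), Function.Injective t ∧
      ∀ p q, (cyclePendant 3 m).Adj p q ↔ p ≠ q ∧ ((p = t 0 ∧ q ≠ t 3) ∨ (q = t 0 ∧ p ≠ t 3) ∨
        s(p, q) = s(t 1, t 2) ∨ s(p, q) = s(t 1, t 3)) := by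
  set w : Σ i : Fin 3, Fin (m i) := ⟨1, Fin.cast h1.symm 0⟩ with hw
  have hm : ∀ r : Σ i : Fin 3, Fin (m i), r = w ∨ (r ≠ w ∧ r.1 = 0) := by
    rintro ⟨i, k⟩
    fin_cases i
    · exact Or.inr ⟨fun h => by simpa [hw] using congrArg Sigma.fst h, rfl⟩
    · refine Or.inl ?_
      have hk : ∀ k k' : Fin (m 1), k = k' := fun k k' => Fin.ext (by omega)
      exact congrArg (Sigma.mk (1 : Fin 3)) (hk k _)
    · exact (Fin.cast h2 k).elim0
  refine ⟨![Sum.inl 0, Sum.inl 1, Sum.inl 2, Sum.inr w], ?_, ?_⟩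
  · intro i j
    fin_cases i <;> fin_cases j <;> simp
  simp only [Matrix.cons_val]
  have hw1 : w.1 = 1 := rfl
  rintro (i | p) (j | q)
  · have : (cyclePendant 3 m).Adj (Sum.inl i) (Sum.inl j) ↔ i ≠ j := cycleGraph_three_adj i j
    rw [this]
    simp only [Sym2.eq_iff, ne_eq, Sum.inl.injEq, reduceCtorEq, not_false_eq_true, and_true,
      and_false]
    clear this
    revert i j; decide
  · have : (cyclePendant 3 m).Adj (Sum.inl i) (Sum.inr q) ↔ q.1 = i := Iff.rfl
    rw [this]
    rcases hm q with rfl | ⟨hq, hq'⟩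
    · simp [hw1, eq_comm]
    · simp [hq, hq', eq_comm]
  · have : (cyclePendant 3 m).Adj (Sum.inr p) (Sum.inl j) ↔ p.1 = j := Iff.rfl
    rw [this]
    rcases hm p with rfl | ⟨hq, hq'⟩
    · simp [hw1, eq_comm]
    · simp [hq, hq', eq_comm]
  · have : (cyclePendant 3 m).Adj (Sum.inr p) (Sum.inr q) ↔ False := Iff.rfl
    rw [this]
    simp

theorem card_cyclePendant_three (m : Fin 3 → ℕ) :
    Fintype.card (Fin 3 ⊕ Σ i : Fin 3, Fin (m i)) = 3 + (m 0 + m 1 + m 2) := by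
  simp [Fin.sum_univ_three]

theorem card_maxUnicyclic {n : ℕ} (hn : 3 ≤ n) :
    Fintype.card (Fin 3 ⊕ Σ i : Fin 3, Fin ((![n - 3, 0, 0] : Fin 3 → ℕ) i)) = n := by
  rw [card_cyclePendant_three]
  simp only [Matrix.cons_val]
  omega

theorem card_secondMaxUnicyclic {n : ℕ} (hn : 4 ≤ n) :
    Fintype.card (Fin 3 ⊕ Σ i : Fin 3, Fin ((![n - 4, 1, 0] : Fin 3 → ℕ) i)) = n := by
  rw [card_cyclePendant_three]
  simp only [Matrix.cons_val]
  omega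

/-- The vertex `t 3` is adjacent only to `t 1`, so only `t 1` could dominate, and it misses any
fifth vertex. On four vertices `t 1` does dominate. -/
theorem exists_not_adj_of_adj_iff {V : Type*} [Fintype V] {G : SimpleGraph V}
    (hcard : 5 ≤ Fintype.card V) {t : Fin 4 → V} (ht : Function.Injective t)
    (hG : ∀ p q, G.Adj p q ↔ p ≠ q ∧ ((p = t 0 ∧ q ≠ t 3) ∨ (q = t 0 ∧ p ≠ t 3) ∨
        s(p, q) = s(t 1, t 2) ∨ s(p, q) = s(t 1, t 3))) (c : V) : ∃ y, y ≠ c ∧ ¬ G.Adj c y := by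
  have hne : ∀ {i j}, i ≠ j → t i ≠ t j := fun h e => h (ht e)
  have h01 := hne (show (0 : Fin 4) ≠ 1 by decide)
  have h02 := hne (show (0 : Fin 4) ≠ 2 by decide)
  have h03 := hne (show (0 : Fin 4) ≠ 3 by decide)
  have h12 := hne (show (1 : Fin 4) ≠ 2 by decide)
  have h13 := hne (show (1 : Fin 4) ≠ 3 by decide)
  have h23 := hne (show (2 : Fin 4) ≠ 3 by decide)
  by_cases hc1 : c = t 1
  · obtain ⟨z, hz⟩ : ∃ z, ∀ i, t i ≠ z := by
      by_contra! h
      have := Fintype.card_le_of_surjective t h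
      rw [Fintype.card_fin] at this
      omega
    refine ⟨z, fun h => hz 1 (hc1 ▸ h.symm), ?_⟩
    rw [hG, Sym2.eq_iff, Sym2.eq_iff]
    have := hz 0; have := hz 2; have := hz 3
    subst hc1
    tauto
  · by_cases hc3 : c = t 3
    · refine ⟨t 0, by rw [hc3]; exact h03, ?_⟩
      rw [hG, Sym2.eq_iff, Sym2.eq_iff]
      tauto
    · refine ⟨t 3, Ne.symm hc3, ?_⟩
      rw [hG, Sym2.eq_iff, Sym2.eq_iff]
      tauto

theorem exists_not_adj_of_iso {V W : Type*} {G : SimpleGraph V} {H : SimpleGraph W} (e : G ≃g H)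
    (hG : ∀ c, ∃ y, y ≠ c ∧ ¬ G.Adj c y) (c : W) : ∃ y, y ≠ c ∧ ¬ H.Adj c y := by
  obtain ⟨y, hy, h⟩ := hG (e.symm c)
  refine ⟨e y, fun h' => hy (by rw [← h', e.symm_apply_apply]), fun h' => h ?_⟩
  rw [← e.map_adj_iff, e.apply_symm_apply]
  exact h'

theorem maxUnicyclic_adj {n : ℕ} (y : Fin 3 ⊕ Σ i : Fin 3, Fin ((![n - 3, 0, 0] : Fin 3 → ℕ) i))
    (hy : y ≠ Sum.inl 0) : (maxUnicyclic n).Adj (Sum.inl 0) y :=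
  (cyclePendant_three_adj_iff rfl rfl _ _).2 ⟨hy.symm, Or.inl rfl⟩

section

variable {V : Type*} [Fintype V] [DecidableEq V] {G : SimpleGraph V} [DecidableRel G.Adj] {n : ℕ}

theorem nonempty_iso_maxUnicyclic_iff (hn : 3 ≤ n) (hcard : Fintype.card V = n)
    (hG : G.IsUnicyclic) :
    Nonempty (G ≃g maxUnicyclic n) ↔ ¬ ∀ c, ∃ y, y ≠ c ∧ ¬ G.Adj c y := by
  constructor
  · rintro ⟨e⟩ h
    obtain ⟨y, hy, h'⟩ := exists_not_adj_of_iso e h (Sum.inl 0)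
    exact h' (maxUnicyclic_adj y hy)
  · intro h
    push Not at h
    obtain ⟨c, hc⟩ := h
    obtain ⟨x, y, h1, h2, h3, h4⟩ := hG.adj_iff_of_dominating hc
    exact nonempty_iso_of_dominating (hcard.trans (card_maxUnicyclic hn).symm) h1 h2 h3 h4
      (by simp) (by simp) (by simp) (cyclePendant_three_adj_iff rfl rfl)

/-- A maximiser over a finite set cannot be improved, hence satisfies `T`. So improvability off `T`
suffices and no chain of shifts has to be followed. -/
theorem le_and_eq_iff_of_forall_exists_lt {α : Type*} [Finite α] {s : Set α} {f : α → ℝ}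
    {T : α → Prop} {m : ℝ} (hT : ∀ a ∈ s, T a → f a = m)
    (hlt : ∀ a ∈ s, ¬ T a → ∃ b ∈ s, f a < f b) {a : α} (ha : a ∈ s) :
    f a ≤ m ∧ (f a = m ↔ T a) := by
  obtain ⟨a₀, h₀, hmax⟩ := Set.exists_max_image s f s.toFinite ⟨a, ha⟩
  have hT₀ : T a₀ := by
    by_contra h
    obtain ⟨b, hb, hab⟩ := hlt a₀ h₀ h
    exact absurd (hmax b hb) (not_le.2 hab)
  have hm := hT a₀ h₀ hT₀
  refine ⟨hm ▸ hmax a ha, fun h => ?_, hT a ha⟩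
  by_contra h'
  obtain ⟨b, hb, hab⟩ := hlt a ha h'
  exact absurd (hmax b hb) (not_le.2 (by rw [hm, ← h]; exact hab))

omit [DecidableRel G.Adj] in
theorem slee_eq_slee (h₁ h₂ : DecidableRel G.Adj) :
    @slee V _ _ G h₁ = @slee V _ _ G h₂ :=
  @slee_congr V V _ _ _ _ G h₁ G h₂ (Iso.refl)

theorem IsUnicyclic.slee_le_slee_maxUnicyclic (hn : 3 ≤ n) (hcard : Fintype.card V = n)
    (hG : G.IsUnicyclic) : G.slee ≤ (maxUnicyclic n).slee ∧
      (G.slee = (maxUnicyclic n).slee ↔ Nonempty (G ≃g maxUnicyclic n)) := by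
  have key := le_and_eq_iff_of_forall_exists_lt (s := {H : SimpleGraph V | H.IsUnicyclic})
    (f := fun H => @slee V _ _ H (Classical.decRel _))
    (T := fun H => Nonempty (H ≃g maxUnicyclic n)) (m := (maxUnicyclic n).slee)
    (fun H _ ⟨e⟩ => by
      classical
      exact slee_congr e)
    (fun H hH hHn => by
      classical
      have hH : H.IsUnicyclic := hH
      rw [nonempty_iso_maxUnicyclic_iff hn hcard hH, not_not] at hHn
      obtain ⟨G', inst, h1, h2⟩ := hH.exists_slee_lt hHn
      refine ⟨G', h1, ?_⟩
      rw [slee_eq_slee (G := G') (Classical.decRel _) inst]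
      convert h2)
    (a := G) hG
  simpa only [slee_eq_slee (G := G) (Classical.decRel _) inferInstance] using key

theorem IsUnicyclic.slee_le_slee_secondMaxUnicyclic (hn : 5 ≤ n) (hcard : Fintype.card V = n)
    (hG : G.IsUnicyclic) (hGn : ∀ c, ∃ y, y ≠ c ∧ ¬ G.Adj c y) :
    G.slee ≤ (secondMaxUnicyclic n).slee ∧
      (G.slee = (secondMaxUnicyclic n).slee ↔ Nonempty (G ≃g secondMaxUnicyclic n)) := by
  have key := le_and_eq_iff_of_forall_exists_lt
    (s := {H : SimpleGraph V | H.IsUnicyclic ∧ ∀ c, ∃ y, y ≠ c ∧ ¬ H.Adj c y})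
    (f := fun H => @slee V _ _ H (Classical.decRel _))
    (T := fun H => Nonempty (H ≃g secondMaxUnicyclic n)) (m := (secondMaxUnicyclic n).slee)
    (fun H _ ⟨e⟩ => by
      classical
      exact slee_congr e)
    (fun H hH hHn => by
      classical
      obtain ⟨hH, hH'⟩ := hH
      rcases hH.exists_slee_lt_or_adj_iff (hcard ▸ hn) hH' with ⟨G', inst, h1, h2, h3⟩ | ⟨t, h1, h2⟩
      · refine ⟨G', ⟨h1, h2⟩, ?_⟩
        rw [slee_eq_slee (G := G') (Classical.decRel _) inst]
        convert h3
      · obtain ⟨t', h3, h4⟩ := cyclePendant_three_exists_adj_iff (m := ![n - 4, 1, 0]) rfl rfl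
        exact absurd (nonempty_iso_of_almost_dominating
          (hcard.trans (card_secondMaxUnicyclic (by omega)).symm) h1 h2 h3 h4) hHn)
    (a := G) ⟨hG, hGn⟩
  simpa only [slee_eq_slee (G := G) (Classical.decRel _) inferInstance] using key

end

/-- Both are a triangle with one pendant vertex, attached at differently labelled corners. -/
theorem nonempty_secondMaxUnicyclic_four_iso : Nonempty (secondMaxUnicyclic 4 ≃g maxUnicyclic 4) := by
  rw [nonempty_iso_maxUnicyclic_iff (by norm_num) (card_secondMaxUnicyclic le_rfl)
    (isUnicyclic_cyclePendant_three _)]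
  decide

theorem slee_secondMaxUnicyclic_lt {n : ℕ} (hn : 5 ≤ n) :
    (secondMaxUnicyclic n).slee < (maxUnicyclic n).slee := by
  have hU := isUnicyclic_cyclePendant_three ![n - 4, 1, 0]
  have hc := card_secondMaxUnicyclic (n := n) (by omega)
  obtain ⟨h1, h2⟩ := hU.slee_le_slee_maxUnicyclic (n := n) (by omega) hc
  refine lt_of_le_of_ne h1 fun h => ?_
  have h3 := h2.1 h
  rw [nonempty_iso_maxUnicyclic_iff (by omega) hc hU] at h3
  obtain ⟨t, ht, h4⟩ := cyclePendant_three_exists_adj_iff (m := ![n - 4, 1, 0]) rfl rfl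
  exact h3 (exists_not_adj_of_adj_iff (by omega) ht h4)

end SimpleGraph

theorem mainTheorem1 (n : ℕ) :
    -- the first maximum
    (3 ≤ n →
      (SimpleGraph.maxUnicyclic n).IsUnicyclic ∧
      Fintype.card (Fin 3 ⊕ Σ i : Fin 3, Fin ((![n - 3, 0, 0] : Fin 3 → ℕ) i)) = n ∧
      ∀ (V : Type*) [Fintype V] [DecidableEq V] (G : SimpleGraph V) [DecidableRel G.Adj],
        Fintype.card V = n → G.IsUnicyclic →
          G.slee ≤ (SimpleGraph.maxUnicyclic n).slee ∧
          (G.slee = (SimpleGraph.maxUnicyclic n).slee ↔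
            Nonempty (G ≃g SimpleGraph.maxUnicyclic n))) ∧
    -- the second maximum
    (4 ≤ n →
      (SimpleGraph.secondMaxUnicyclic n).IsUnicyclic ∧
      Fintype.card (Fin 3 ⊕ Σ i : Fin 3, Fin ((![n - 4, 1, 0] : Fin 3 → ℕ) i)) = n ∧
      ∀ (V : Type*) [Fintype V] [DecidableEq V] (G : SimpleGraph V) [DecidableRel G.Adj],
        Fintype.card V = n → G.IsUnicyclic → ¬ Nonempty (G ≃g SimpleGraph.maxUnicyclic n) →
          G.slee ≤ (SimpleGraph.secondMaxUnicyclic n).slee ∧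
          (G.slee = (SimpleGraph.secondMaxUnicyclic n).slee ↔
            Nonempty (G ≃g SimpleGraph.secondMaxUnicyclic n))) ∧
    -- the two extremal values differ
    (5 ≤ n → (SimpleGraph.secondMaxUnicyclic n).slee < (SimpleGraph.maxUnicyclic n).slee) := by
  refine ⟨fun hn => ⟨SimpleGraph.isUnicyclic_cyclePendant_three _,
    SimpleGraph.card_maxUnicyclic hn, ?_⟩, fun hn =>
    ⟨SimpleGraph.isUnicyclic_cyclePendant_three _, SimpleGraph.card_secondMaxUnicyclic hn, ?_⟩,
    SimpleGraph.slee_secondMaxUnicyclic_lt⟩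
  · intro V _ _ G _ hcard hG
    exact hG.slee_le_slee_maxUnicyclic hn hcard
  · intro V _ _ G _ hcard hG hGn
    -- For n = 4 the graphs G⁽¹⁾ and G⁽²⁾ are isomorphic, so the bound is the first maximum, and
    -- both sides of the equality criterion contradict `hGn`.
    rcases hn.eq_or_lt with rfl | hn'
    · obtain ⟨e⟩ := SimpleGraph.nonempty_secondMaxUnicyclic_four_iso
      obtain ⟨h1, h2⟩ := hG.slee_le_slee_maxUnicyclic (by norm_num) hcard
      rw [SimpleGraph.slee_congr e]
      exact ⟨h1, fun h => (hGn (h2.1 h)).elim, fun ⟨e'⟩ => (hGn ⟨e'.trans e⟩).elim⟩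
    · rw [SimpleGraph.nonempty_iso_maxUnicyclic_iff (by omega) hcard hG, not_not] at hGn
      exact hG.slee_le_slee_secondMaxUnicyclic hn' hcard hGn
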